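/- Let $D\ge 0$, let $X^M=(\tilde x_i,x^i)$, $M=1,\dots,2D$, be coordinates on $\mathbb R^{2D}$, $\partial_M=(\tilde\partial^i,\partial_i)$, and raise and lower indices with the constant matrix $\eta_{MN}=\begin{pmatrix}0&1\\1&0\end{pmatrix}$. Let $\mathcal H_{MN}$ be a smooth symmetric matrix field with $\mathcal H\eta\mathcal H=\eta^{-1}$, $d$ a smooth function (dilaton) and $\xi^M$ a smooth vector field (gauge parameter), subject to the strong constraint: $\partial^M\partial_M A=0$ and $\partial^M\partial_M(AB)=0$ whenever each of $A,B$ is a component of $\mathcal H$ or $\xi$, or $d$, or a partial derivative of any order of one of these. Put $S^M{}_N=\mathcal H^M{}_N$, $a_{(M}b_{N)}=\tfrac12(a_Mb_N+a_Nb_M)$, and $$\begin{aligned}\mathcal K_{MN}={}&\tfrac18\partial_M\mathcal H^{KL}\partial_N\mathcal H_{KL}-\tfrac14(\partial_L-2(\partial_Ld))(\mathcal H^{LK}\partial_K\mathcal H_{MN})+2\partial_M\partial_Nd\\&-\tfrac12\partial_{(M}\mathcal H^{KL}\partial_L\mathcal H_{N)K}+\tfrac12(\partial_L-2(\partial_Ld))\big(\mathcal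 H^{KL}\partial_{(M}\mathcal H_{N)K}+\mathcal H^K{}_{(M}\partial_K\mathcal H^L{}_{N)}\big),\end{aligned}$$ $$\mathcal R=\tfrac14(1-S^t)\mathcal K(1+S)+\tfrac14(1+S^t)\mathcal K(1-S).$$ For a field $A_{MN}$ the generalized Lie derivative is $$\hat{\mathcal L}_\xi A_{MN}=\xi^P\partial_PA_{MN}+(\partial_M\xi^P-\partial^P\xi_M)A_{PN}+(\partial_N\xi^P-\partial^P\xi_N)A_{MP}.$$ The gauge variations of the fields are $\delta_\xi\mathcal H_{MN}=\hat{\mathcal L}_\xi\mathcal H_{MN}$ and $\delta_\xi d=-\tfrac12\partial_M\xi^M+\xi^M\partial_Md$, and for $W=W[\mathcal H,d]$ let $\delta_\xi W=\frac{d}{d\varepsilon}\big|_{\varepsilon=0}W[\mathcal H+\varepsilon\,\delta_\xi\mathcal H,\,d+\varepsilon\,\delta_\xi d]$. Then: 1. The non-tensorial part $\Delta_\xi\mathcal K=\delta_\xi\mathcal K-\hat{\mathcal L}_\xi\mathcal K$ of the variation of $\mathcal K$ is $$\Delta_\xi\mathcal K=\mathcal T+S^t\,\mathcal T\,S,$$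 where $$\begin{aligned}\mathcal T_{MN}={}&-\tfrac14\partial_M\partial_N(\partial_P\xi^P)+\tfrac12(\partial_M\partial_N\xi^P)\,\partial_Pd+\tfrac14(\partial_M\mathcal H^L{}_P)\,\mathcal H^K{}_N\,\partial_L(\partial_K\xi^P-\partial^P\xi_K)\\&-\tfrac12\mathcal H^P{}_M\,(\partial_L\partial_P\xi^Q)\,\partial_Q\mathcal H^L{}_N+\{M\leftrightarrow N\},\end{aligned}$$ and $\{M\leftrightarrow N\}$ stands for all four preceding terms with $M$ and $N$ exchanged. 2. $\mathcal R_{MN}$ is a generalized tensor: $\delta_\xi\mathcal R_{MN}=\hat{\mathcal L}_\xi\mathcal R_{MN}$ for all such $\mathcal H,d,\xi$. 3. $\mathcal K_{MN}$ is not: for every $D\ge1$ there are a smooth invertible symmetric $g_{ij}$, a smooth antisymmetric $b_{ij}$, and smooth $d,\xi$ such that, for $$\mathcal H=\begin{pmatrix}g^{-1}&-g^{-1}b\\ bg^{-1}&g-bg^{-1}b\end{pmatrix},$$ the hypotheses above hold but $\delta_\xi\mathcal K_{MN}\ne\hat{\mathcal L}_\xi\mathcal K_{MN}$. -/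

import Mathlib

open scoped ContDiff

namespace DFT

noncomputable section

/-- Doubled indices `M = 1, …, 2D`. The value `inl i` labels the winding coordinate `x̃_i` and
`inr i` labels the coordinate `x^i`, so that `∂_M = (∂̃^i, ∂_i)` and `ξ^M = (ξ̃_i, ξ^i)`. -/
abbrev Idx (D : ℕ) : Type := Fin D ⊕ Fin D

/-- The doubled space, with coordinates `X^M = (x̃_i, x^i)`. -/
abbrev Pt (D : ℕ) : Type := Idx D → ℝ

/-- A field `A_{MN}` with two lower indices. -/
abbrev TensorField (D : ℕ) : Type := Pt D → Matrix (Idx D) (Idx D) ℝ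

/-- A vector field `ξ^M` (upper index). -/
abbrev VecField (D : ℕ) : Type := Pt D → Idx D → ℝ

/-- The constant `O(D,D)` metric `η_{MN}`; it equals its own inverse `η^{MN}`. -/
def eta (D : ℕ) : Matrix (Idx D) (Idx D) ℝ := Matrix.fromBlocks 0 1 1 0

variable {D : ℕ}

/-- The partial derivative `∂_M f`. -/
def pd (M : Idx D) (f : Pt D → ℝ) (X : Pt D) : ℝ := fderiv ℝ f X (Pi.single M 1)

/-- The derivative `∂^M f = η^{MN} ∂_N f`. -/
def pdUp (M : Idx D) (f : Pt D → ℝ) (X : Pt D) : ℝ := ∑ N, eta D M N * pd N f X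

/-- The operator `∂^M ∂_M`. -/
def box (f : Pt D → ℝ) (X : Pt D) : ℝ := ∑ M, pdUp M (pd M f) X

/-- The lowered parameter `ξ_M = η_{MN} ξ^N`. -/
def low (ξ : VecField D) (M : Idx D) (X : Pt D) : ℝ := ∑ N, eta D M N * ξ X N

/-- The divergence `∂ · ξ = ∂_P ξ^P`. -/
def divg (ξ : VecField D) (X : Pt D) : ℝ := ∑ P, pd P (fun Y => ξ Y P) X

/-- The matrix `S^M{}_N = H^M{}_N = η^{MK} H_{KN}`. -/
def sMat (H : TensorField D) : TensorField D := fun X => eta D * H X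

/-- The generalized metric with both indices raised, `H^{MN} = η^{MK} H_{KL} η^{LN}`. -/
def upMat (H : TensorField D) : TensorField D := fun X => eta D * H X * eta D

/-- The operation `(∂_L - 2 (∂_L d)) V^L`, in which `∂_L` acts on `V^L`. -/
def dilDiv (d : Pt D → ℝ) (V : Idx D → Pt D → ℝ) (X : Pt D) : ℝ :=
  ∑ L, (pd L (V L) X - 2 * pd L d X * V L X)

/-- The generalized Lie derivative of a field with two lower indices:
`ξ^P ∂_P A_{MN} + (∂_M ξ^P - ∂^P ξ_M) A_{PN} + (∂_N ξ^P - ∂^P ξ_N) A_{MP}`. -/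
def genLie (ξ : VecField D) (A : TensorField D) : TensorField D := fun X => Matrix.of fun M N =>
  ∑ P, (ξ X P * pd P (fun Y => A Y M N) X
    + (pd M (fun Y => ξ Y P) X - pdUp P (low ξ M) X) * A X P N
    + (pd N (fun Y => ξ Y P) X - pdUp P (low ξ N) X) * A X M P)

/-- The gauge variation of the dilaton, `δ_ξ d = -½ ∂_M ξ^M + ξ^M ∂_M d`. -/
def varDil (ξ : VecField D) (d : Pt D → ℝ) (X : Pt D) : ℝ :=
  -(1 / 2) * divg ξ X + ∑ M, ξ X M * pd M d X

/-- `W[H, d]` has the gauge variation `δ_ξ W = V` at `(H, d)`: every component of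
`W[H + ε δ_ξ H, d + ε δ_ξ d]`, with `δ_ξ H` the generalized Lie derivative of `H`, is
differentiable at `ε = 0` with derivative the corresponding component of `V`. -/
def HasGaugeVariation (W : TensorField D → (Pt D → ℝ) → TensorField D)
    (H : TensorField D) (d : Pt D → ℝ) (ξ : VecField D) (V : TensorField D) : Prop :=
  ∀ (X : Pt D) (M N : Idx D),
    HasDerivAt (fun ε : ℝ => W (H + ε • genLie ξ H) (d + ε • varDil ξ d) X M N) (V X M N) 0

/-- The terms of `K_{MN}` that are symmetrized in `M, N`, before symmetrization. -/
def kinAux (H : TensorField D) (d : Pt D → ℝ) (X : Pt D) (M N : Idx D) : ℝ :=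
  -(1 / 2) * ∑ K, ∑ L, pd M (fun Y => upMat H Y K L) X * pd L (fun Y => H Y N K) X
  + 1 / 2 * dilDiv d (fun L Y => ∑ K,
      (upMat H Y K L * pd M (fun Z => H Z N K) Y
        + sMat H Y K M * pd K (fun Z => sMat H Z L N) Y)) X

/-- The field `K_{MN}[H, d]`:
`⅛ ∂_M H^{KL} ∂_N H_{KL} - ¼ (∂_L - 2 ∂_L d)(H^{LK} ∂_K H_{MN}) + 2 ∂_M ∂_N d
- ½ ∂_{(M} H^{KL} ∂_L H_{N)K}
+ ½ (∂_L - 2 ∂_L d)(H^{KL} ∂_{(M} H_{N)K} + H^K{}_{(M} ∂_K H^L{}_{N)})`,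
where `a_{(M} b_{N)} = ½ (a_M b_N + a_N b_M)`. -/
def kField (H : TensorField D) (d : Pt D → ℝ) : TensorField D := fun X => Matrix.of fun M N =>
  1 / 8 * (∑ K, ∑ L, pd M (fun Y => upMat H Y K L) X * pd N (fun Y => H Y K L) X)
  - 1 / 4 * dilDiv d (fun L Y => ∑ K, upMat H Y L K * pd K (fun Z => H Z M N) Y) X
  + 2 * pd M (pd N d) X
  + 1 / 2 * (kinAux H d X M N + kinAux H d X N M)

/-- The field `R = ¼ (1 - Sᵗ) K (1 + S) + ¼ (1 + Sᵗ) K (1 - S)`. -/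
def rField (H : TensorField D) (d : Pt D → ℝ) : TensorField D := fun X =>
  (1 / 4 : ℝ) • ((1 - (sMat H X).transpose) * kField H d X * (1 + sMat H X))
  + (1 / 4 : ℝ) • ((1 + (sMat H X).transpose) * kField H d X * (1 - sMat H X))

/-- The terms of `T_{MN}` to which the terms with `M` and `N` exchanged are added. -/
def tAux (H : TensorField D) (d : Pt D → ℝ) (ξ : VecField D) (X : Pt D) (M N : Idx D) : ℝ :=
  -(1 / 4) * pd M (pd N (divg ξ)) X
  + 1 / 2 * ∑ P, pd M (pd N (fun Y => ξ Y P)) X * pd P d X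
  + 1 / 4 * ∑ L, ∑ P, ∑ K, pd M (fun Y => sMat H Y L P) X * sMat H X K N
      * pd L (fun Y => pd K (fun Z => ξ Z P) Y - pdUp P (low ξ K) Y) X
  - 1 / 2 * ∑ P, ∑ L, ∑ Q, sMat H X P M * pd L (pd P (fun Y => ξ Y Q)) X
      * pd Q (fun Y => sMat H Y L N) X

/-- The field `T_{MN}`. -/
def tField (H : TensorField D) (d : Pt D → ℝ) (ξ : VecField D) : TensorField D :=
  fun X => Matrix.of fun M N => tAux H d ξ X M N + tAux H d ξ X N M

/-- The fields and gauge parameters of the theory: the components of `H`, the dilaton `d`, the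
components of `ξ`, and all their partial derivatives. -/
inductive IsField (H : TensorField D) (d : Pt D → ℝ) (ξ : VecField D) : (Pt D → ℝ) → Prop
  | metric (M N : Idx D) : IsField H d ξ (fun X => H X M N)
  | dilaton : IsField H d ξ d
  | param (M : Idx D) : IsField H d ξ (fun X => ξ X M)
  | deriv (M : Idx D) (A : Pt D → ℝ) : IsField H d ξ A → IsField H d ξ (pd M A)

/-- The strong constraint: `∂^M ∂_M` annihilates all fields and gauge parameters and all their
products. -/
def StrongConstraint (H : TensorField D) (d : Pt D → ℝ) (ξ : VecField D) : Prop :=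
  (∀ A, IsField H d ξ A → ∀ X, box A X = 0) ∧
  (∀ A B, IsField H d ξ A → IsField H d ξ B → ∀ X, box (fun Y => A Y * B Y) X = 0)

/-- `H` is a generalized metric: smooth and symmetric, with `H η H = η⁻¹` (and `η⁻¹ = η`). -/
structure IsGenMetric (H : TensorField D) : Prop where
  smooth : ∀ M N, ContDiff ℝ ∞ (fun X => H X M N)
  symm : ∀ X, (H X).IsSymm
  constr : ∀ X, H X * eta D * H X = eta D

/-- The fields on which the theory is formulated: a generalized metric `H`, a smooth dilaton and a
smooth gauge parameter, subject to the strong constraint. -/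
structure Admissible (H : TensorField D) (d : Pt D → ℝ) (ξ : VecField D) : Prop where
  genMetric : IsGenMetric H
  smooth_dil : ContDiff ℝ ∞ d
  smooth_param : ∀ M, ContDiff ℝ ∞ (fun X => ξ X M)
  strong : StrongConstraint H d ξ

/-- The generalized metric `H_{MN}` of a metric `g_{ij}` and a two-form `b_{ij}`. -/
def metricOf (g b : Pt D → Matrix (Fin D) (Fin D) ℝ) : TensorField D := fun X =>
  Matrix.fromBlocks (g X)⁻¹ (-((g X)⁻¹ * b X)) (b X * (g X)⁻¹) (g X - b X * (g X)⁻¹ * b X)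

end

end DFT

namespace DFT

variable {D : ℕ}

/-! At a point, `K_{MN}` is a polynomial in the jet of the fields: `H`, `∂H`, `∂∂H`, `∂d` and `∂∂d`
(`kField_eq`). Both its gauge variation and its partial derivatives are therefore values of one
linearization, `Jet.kinVar`, and the problem becomes algebra at a single point.

By the Leibniz rule and the strong constraint, the variation of the jet is a sum of three pieces
(`Admissible.fieldJet_variation`): transport along `ξ`; an infinitesimal `O(D,D)` rotation of all
indices, including those of derivatives, by `a_M{}^P = ∂_M ξ^P - ∂^P ξ_M`; and an anomaly linear in
`∂∂ξ` and `∂∂∂ξ`. Transport gives `ξ^P ∂_P K`. All contractions in `K` are made with `η`, so the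
rotation acts only on the free indices (`Jet.kinVar_rot`). These two pieces make up the generalized
Lie derivative, so `Δ_ξ K` is the linearization evaluated on the anomaly.

That evaluation is the computational core, `JetRelations.sum_prodPartVar_anomaly`. It uses only
relations at the point: symmetry, `HηH = η` and its first derivative, and the vanishing contractions
supplied by the strong constraint. Because `S² = 1`, conjugating a term of `T` that carries one
factor `S` moves this factor to the other index, and the result is recognized as `T + Sᵗ T S`
(`JetRelations.tPart_add_conjS`, `JetRelations.sum_kinVar_anomaly`).

For `R`, `rField_eq` gives `R = ½ (K - Sᵗ K S)`. As `S` is a tensor, `Δ_ξ R = ½ (Δ_ξ K - Sᵗ (Δ_ξ K)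
S)`, which is zero because `T + Sᵗ T S` is fixed by conjugation with `S`. For the failure of `K`, a
flat background with one cubic component of `ξ` leaves only the term `∂_M ∂_N (∂ · ξ)` in `T`. -/

/-- The index `M̄` paired with `M` by the metric `η`. -/
abbrev bar : Idx D → Idx D := Sum.swap

theorem bar_bar (a : Idx D) : bar (bar a) = a := Sum.swap_swap a

theorem eta_apply (M N : Idx D) : eta D M N = if N = bar M then 1 else 0 := by
  rcases M with i | i <;> rcases N with j | j <;> simp [eta, Matrix.one_apply, bar, eq_comm]

theorem sum_eta_mul (M : Idx D) (f : Idx D → ℝ) : ∑ N, eta D M N * f N = f (bar M) := by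
  simp [eta_apply]

theorem sum_mul_eta (N : Idx D) (f : Idx D → ℝ) : ∑ M, f M * eta D M N = f (bar N) := by
  have : ∀ M, (N = bar M ↔ M = bar N) := fun M => ⟨fun h => by rw [h, bar_bar], fun h => by
    rw [h, bar_bar]⟩
  simp [eta_apply, this]

theorem pdUp_eq (M : Idx D) (f : Pt D → ℝ) (X : Pt D) : pdUp M f X = pd (bar M) f X := by
  simp only [pdUp, sum_eta_mul M (fun N => pd N f X)]

theorem low_eq (ξ : VecField D) (M : Idx D) : low ξ M = fun X => ξ X (bar M) := by
  funext X
  simp only [low, sum_eta_mul M (fun N => ξ X N)]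

theorem sMat_apply (H : TensorField D) (X : Pt D) (M N : Idx D) :
    sMat H X M N = H X (bar M) N := by
  simp only [sMat, Matrix.mul_apply, sum_eta_mul M (fun K => H X K N)]

theorem upMat_apply (H : TensorField D) (X : Pt D) (M N : Idx D) :
    upMat H X M N = H X (bar M) (bar N) := by
  have h : ∀ K, (eta D * H X) M K = H X (bar M) K := fun K => sMat_apply H X M K
  simp only [upMat]
  rw [Matrix.mul_apply]
  simp only [h, sum_mul_eta N (fun K => H X (bar M) K)]

/-! ### Calculus of partial derivatives of smooth functions -/

section Calculus

variable {f g : Pt D → ℝ}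

theorem _root_.ContDiff.pd (hf : ContDiff ℝ ∞ f) (M : Idx D) : ContDiff ℝ ∞ (pd M f) :=
  (hf.fderiv_right (m := ∞) (by simp)).clm_apply contDiff_const

theorem hasDerivAt_pd (hf : ContDiff ℝ ∞ f) (M : Idx D) (X : Pt D) :
    HasDerivAt (fun t : ℝ => f (X + t • Pi.single M 1)) (pd M f X) 0 :=
  ((hf.differentiable (by simp)) X).hasFDerivAt.hasLineDerivAt _

theorem pd_eq_of_hasDerivAt (hf : ContDiff ℝ ∞ f) {M : Idx D} {X : Pt D} {c : ℝ}
    (h : HasDerivAt (fun t : ℝ => f (X + t • Pi.single M 1)) c 0) : pd M f X = c :=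
  (hasDerivAt_pd hf M X).unique h

theorem pd_add (hf : ContDiff ℝ ∞ f) (hg : ContDiff ℝ ∞ g) (M : Idx D) :
    pd M (fun Y => f Y + g Y) = fun X => pd M f X + pd M g X := by
  funext X
  exact pd_eq_of_hasDerivAt (hf.add hg) ((hasDerivAt_pd hf M X).add (hasDerivAt_pd hg M X))

theorem pd_sub (hf : ContDiff ℝ ∞ f) (hg : ContDiff ℝ ∞ g) (M : Idx D) :
    pd M (fun Y => f Y - g Y) = fun X => pd M f X - pd M g X := by
  funext X
  exact pd_eq_of_hasDerivAt (hf.sub hg) ((hasDerivAt_pd hf M X).sub (hasDerivAt_pd hg M X))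

theorem pd_const_mul (hf : ContDiff ℝ ∞ f) (c : ℝ) (M : Idx D) :
    pd M (fun Y => c * f Y) = fun X => c * pd M f X := by
  funext X
  exact pd_eq_of_hasDerivAt (contDiff_const.mul hf) ((hasDerivAt_pd hf M X).const_mul c)

theorem pd_const (c : ℝ) (M : Idx D) : pd M (fun _ => c) = fun _ => 0 := by
  funext X
  simp [pd]

theorem pd_mul (hf : ContDiff ℝ ∞ f) (hg : ContDiff ℝ ∞ g) (M : Idx D) :
    pd M (fun Y => f Y * g Y) = fun X => pd M f X * g X + f X * pd M g X := by
  funext X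
  refine pd_eq_of_hasDerivAt (hf.mul hg) ?_
  simpa using (hasDerivAt_pd hf M X).fun_mul (hasDerivAt_pd hg M X)

theorem pd_sum {ι : Type*} (s : Finset ι) {F : ι → Pt D → ℝ} (hF : ∀ i, ContDiff ℝ ∞ (F i))
    (M : Idx D) : pd M (fun Y => ∑ i ∈ s, F i Y) = fun X => ∑ i ∈ s, pd M (F i) X := by
  funext X
  exact pd_eq_of_hasDerivAt (ContDiff.sum fun i _ => hF i)
    (HasDerivAt.fun_sum fun i _ => hasDerivAt_pd (hF i) M X)

theorem pd_comm (hf : ContDiff ℝ ∞ f) (M N : Idx D) : pd M (pd N f) = pd N (pd M f) := by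
  have key : ∀ (K L : Idx D) (X : Pt D),
      pd K (pd L f) X = fderiv ℝ (fderiv ℝ f) X (Pi.single K 1) (Pi.single L 1) := by
    intro K L X
    have hd : DifferentiableAt ℝ (fderiv ℝ f) X :=
      (hf.fderiv_right (m := ∞) (by simp)).differentiable (by simp) X
    have : HasFDerivAt (fun Y => fderiv ℝ f Y (Pi.single L 1))
        ((fderiv ℝ (fderiv ℝ f) X).flip (Pi.single L 1)) X := by
      simpa using hd.hasFDerivAt.clm_apply (hasFDerivAt_const (Pi.single L (1 : ℝ)) X)
    exact congrArg (fun T => T (Pi.single K 1)) this.fderiv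
  funext X
  rw [key, key]
  exact (hf.contDiffAt.isSymmSndFDerivAt (by
    rw [minSmoothness_of_isRCLikeNormedField]
    exact WithTop.coe_le_coe.2 (le_top : (2 : ℕ∞) ≤ ⊤))) _ _

end Calculus

/-! ### `K` as a polynomial on jets, and its linearization -/

/-- The values at a point of `H`, of the first and second derivatives of `H`, and of the first and
second derivatives of `d`. The indices of the derivatives come first. -/
structure Jet (I : Type*) where
  h : I → I → ℝ
  h1 : I → I → I → ℝ
  h2 : I → I → I → I → ℝ
  d1 : I → ℝ
  d2 : I → I → ℝ

namespace Jet

variable {I : Type*}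

/-- The product terms of `K_{MN}`, before the contraction of `a` with `a'` and of `b` with `b'`,
the symmetrized terms given by `kinPart`. -/
noncomputable def kinPart (j : Jet I) (M N a a' b b' : I) : ℝ :=
  -(1 / 2) * (j.h1 M a' b' * j.h1 b N a)
  + 1 / 2 * (j.h1 b a' b' * j.h1 M N a + j.h a' b' * j.h2 b M N a
    + j.h1 b a' M * j.h1 a b' N + j.h a' M * j.h2 b a b' N)
  - j.d1 b * (j.h a' b' * j.h1 M N a + j.h a' M * j.h1 a b' N)

/-- The product terms of `K_{MN}`, before the contraction of `a` with `a'` and of `b` with `b'`. -/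
noncomputable def prodPart (j : Jet I) (M N a a' b b' : I) : ℝ :=
  1 / 8 * (j.h1 M a' b' * j.h1 N a b)
  - 1 / 4 * (j.h1 a a' b' * j.h1 b M N + j.h a' b' * j.h2 a b M N)
  + 1 / 2 * (j.d1 a * j.h a' b' * j.h1 b M N)
  + 1 / 2 * (kinPart j M N a a' b b' + kinPart j N M a a' b b')

/-- The linearization of `kinPart`. -/
noncomputable def kinPartVar (j v : Jet I) (M N a a' b b' : I) : ℝ :=
  -(1 / 2) * (v.h1 M a' b' * j.h1 b N a + j.h1 M a' b' * v.h1 b N a)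
  + 1 / 2 * (v.h1 b a' b' * j.h1 M N a + j.h1 b a' b' * v.h1 M N a
    + (v.h a' b' * j.h2 b M N a + j.h a' b' * v.h2 b M N a)
    + (v.h1 b a' M * j.h1 a b' N + j.h1 b a' M * v.h1 a b' N)
    + (v.h a' M * j.h2 b a b' N + j.h a' M * v.h2 b a b' N))
  - (v.d1 b * (j.h a' b' * j.h1 M N a + j.h a' M * j.h1 a b' N)
    + j.d1 b * (v.h a' b' * j.h1 M N a + j.h a' b' * v.h1 M N a
      + (v.h a' M * j.h1 a b' N + j.h a' M * v.h1 a b' N)))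

/-- The linearization of `prodPart`. -/
noncomputable def prodPartVar (j v : Jet I) (M N a a' b b' : I) : ℝ :=
  1 / 8 * (v.h1 M a' b' * j.h1 N a b + j.h1 M a' b' * v.h1 N a b)
  - 1 / 4 * (v.h1 a a' b' * j.h1 b M N + j.h1 a a' b' * v.h1 b M N
    + (v.h a' b' * j.h2 a b M N + j.h a' b' * v.h2 a b M N))
  + 1 / 2 * ((v.d1 a * j.h a' b' + j.d1 a * v.h a' b') * j.h1 b M N
    + j.d1 a * j.h a' b' * v.h1 b M N)
  + 1 / 2 * (kinPartVar j v M N a a' b b' + kinPartVar j v N M a a' b b')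

/-- `v` is the derivative at `0` of the curve `c` of jets. -/
structure HasDeriv (c : ℝ → Jet I) (v : Jet I) : Prop where
  h : ∀ a b, HasDerivAt (fun t => (c t).h a b) (v.h a b) 0
  h1 : ∀ k a b, HasDerivAt (fun t => (c t).h1 k a b) (v.h1 k a b) 0
  h2 : ∀ k l a b, HasDerivAt (fun t => (c t).h2 k l a b) (v.h2 k l a b) 0
  d1 : ∀ k, HasDerivAt (fun t => (c t).d1 k) (v.d1 k) 0
  d2 : ∀ k l, HasDerivAt (fun t => (c t).d2 k l) (v.d2 k l) 0

theorem HasDeriv.kinPart {c : ℝ → Jet I} {v : Jet I} (H : HasDeriv c v) (M N a a' b b' : I) :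
    HasDerivAt (fun t => kinPart (c t) M N a a' b b') (kinPartVar (c 0) v M N a a' b b') 0 :=
  (((((H.h1 _ _ _).fun_mul (H.h1 _ _ _)).const_mul (-(1 / 2))).fun_add
    (((((H.h1 _ _ _).fun_mul (H.h1 _ _ _)).fun_add ((H.h _ _).fun_mul (H.h2 _ _ _ _))).fun_add
      ((H.h1 _ _ _).fun_mul (H.h1 _ _ _))).fun_add
        ((H.h _ _).fun_mul (H.h2 _ _ _ _)) |>.const_mul (1 / 2))).fun_sub
    ((H.d1 _).fun_mul (((H.h _ _).fun_mul (H.h1 _ _ _)).fun_add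
      ((H.h _ _).fun_mul (H.h1 _ _ _)))))

theorem HasDeriv.prodPart {c : ℝ → Jet I} {v : Jet I} (H : HasDeriv c v) (M N a a' b b' : I) :
    HasDerivAt (fun t => prodPart (c t) M N a a' b b') (prodPartVar (c 0) v M N a a' b b') 0 :=
  (((((H.h1 _ _ _).fun_mul (H.h1 _ _ _)).const_mul (1 / 8)).fun_sub
    ((((H.h1 _ _ _).fun_mul (H.h1 _ _ _)).fun_add
      ((H.h _ _).fun_mul (H.h2 _ _ _ _))).const_mul (1 / 4))).fun_add
    ((((H.d1 _).fun_mul (H.h _ _)).fun_mul (H.h1 _ _ _)).const_mul (1 / 2))).fun_add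
    (((H.kinPart M N a a' b b').fun_add (H.kinPart N M a a' b b')).const_mul (1 / 2))

variable [Fintype I]

/-- `K_{MN}` as a function of the jet of the fields. -/
noncomputable def kin (σ : I → I) (j : Jet I) (M N : I) : ℝ :=
  2 * j.d2 M N + ∑ a, ∑ b, prodPart j M N a (σ a) b (σ b)

/-- The linearization of `kin`. -/
noncomputable def kinVar (σ : I → I) (j v : Jet I) (M N : I) : ℝ :=
  2 * v.d2 M N + ∑ a, ∑ b, prodPartVar j v M N a (σ a) b (σ b)

theorem HasDeriv.kin {c : ℝ → Jet I} {v : Jet I} (H : HasDeriv c v) (σ : I → I) (M N : I) :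
    HasDerivAt (fun t => kin σ (c t) M N) (kinVar σ (c 0) v M N) 0 :=
  ((H.d2 M N).const_mul 2).fun_add (HasDerivAt.fun_sum fun a _ => HasDerivAt.fun_sum fun b _ =>
    H.prodPart M N a (σ a) b (σ b))

/-- The sum of a finite family of jets, with coefficients. -/
def combo (w : I → ℝ) (v : I → Jet I) : Jet I where
  h a b := ∑ P, w P * (v P).h a b
  h1 k a b := ∑ P, w P * (v P).h1 k a b
  h2 k l a b := ∑ P, w P * (v P).h2 k l a b
  d1 k := ∑ P, w P * (v P).d1 k
  d2 k l := ∑ P, w P * (v P).d2 k l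

theorem prodPartVar_combo (j : Jet I) (w : I → ℝ) (v : I → Jet I) (M N a a' b b' : I) :
    prodPartVar j (combo w v) M N a a' b b' = ∑ P, w P * prodPartVar j (v P) M N a a' b b' := by
  simp only [prodPartVar, kinPartVar, combo, Finset.sum_mul, Finset.mul_sum,
    ← Finset.sum_add_distrib, ← Finset.sum_sub_distrib]
  exact Finset.sum_congr rfl fun P _ => by ring

/-- The linearization is linear in `v`. This is what lets the three pieces of the gauge variation of
the jet be treated separately, and each of them term by term in its summation index. -/
theorem kinVar_combo (σ : I → I) (j : Jet I) (w : I → ℝ) (v : I → Jet I) (M N : I) :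
    kinVar σ j (combo w v) M N = ∑ P, w P * kinVar σ j (v P) M N := by
  simp only [kinVar, prodPartVar_combo, mul_add, Finset.sum_add_distrib]
  congr 1
  · rw [combo, Finset.mul_sum]
    exact Finset.sum_congr rfl fun P _ => by ring
  · simp only [Finset.mul_sum]
    rw [Finset.sum_comm]
    conv_lhs => enter [2, b]; rw [Finset.sum_comm]
    rw [Finset.sum_comm]
    exact Finset.sum_congr rfl fun P _ => Finset.sum_comm

/-- The sum of two jets. -/
def add (u v : Jet I) : Jet I where
  h a b := u.h a b + v.h a b
  h1 k a b := u.h1 k a b + v.h1 k a b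
  h2 k l a b := u.h2 k l a b + v.h2 k l a b
  d1 k := u.d1 k + v.d1 k
  d2 k l := u.d2 k l + v.d2 k l

theorem kinVar_add (σ : I → I) (j u v : Jet I) (M N : I) :
    kinVar σ j (add u v) M N = kinVar σ j u M N + kinVar σ j v M N := by
  have : ∀ a a' b b', prodPartVar j (add u v) M N a a' b b' =
      prodPartVar j u M N a a' b b' + prodPartVar j v M N a a' b b' := by
    intro a a' b b'
    simp only [prodPartVar, kinPartVar, add]
    ring
  simp only [kinVar, this, Finset.sum_add_distrib]
  simp only [add]
  ring

/-- The term labelled by `P` of the action on a jet of the infinitesimal transformation with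
matrix `A`. -/
noncomputable def rotTerm (A : I → I → ℝ) (j : Jet I) (P : I) : Jet I where
  h a b := A a P * j.h P b + A b P * j.h a P
  h1 k a b := A k P * j.h1 P a b + A a P * j.h1 k P b + A b P * j.h1 k a P
  h2 k l a b := A k P * j.h2 P l a b + A l P * j.h2 k P a b
    + A a P * j.h2 k l P b + A b P * j.h2 k l a P
  d1 k := A k P * j.d1 P
  d2 k l := A k P * j.d2 P l + A l P * j.d2 k P

/-- The hypothesis on `A` says that `A` lies in the Lie algebra of `O(D,D)`, so a contraction with
`η` is invariant: renaming `a` and `P` by `σ` and exchanging them turns the second half of the sum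
into minus the first. -/
theorem sum_rot_contract (σ : I → I) (hσ : ∀ a, σ (σ a) = a) (A : I → I → ℝ)
    (hA : ∀ a b, A (σ a) (σ b) = -A b a) (f : I → I → ℝ) :
    ∑ a, ∑ P, (A a P * f P (σ a) + A (σ a) P * f a P) = 0 := by
  have hinv : Function.Involutive σ := hσ
  have : ∑ a, ∑ P, A (σ a) P * f a P = -∑ a, ∑ P, A a P * f P (σ a) := by
    rw [Finset.sum_comm (f := fun a P => A a P * f P (σ a)), ← Finset.sum_neg_distrib]
    refine Finset.sum_congr rfl fun a _ => ?_
    rw [← Finset.sum_neg_distrib, ← Equiv.sum_comp hinv.toPerm]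
    refine Finset.sum_congr rfl fun P _ => ?_
    simp only [Function.Involutive.coe_toPerm]
    rw [hA]; ring
  simp only [Finset.sum_add_distrib, this]
  ring

/-- The covariance of `K` under infinitesimal `O(D,D)` transformations. -/
theorem kinVar_rot (σ : I → I) (hσ : ∀ a, σ (σ a) = a) (A : I → I → ℝ)
    (hA : ∀ a b, A (σ a) (σ b) = -A b a) (j : Jet I) (M N : I) :
    ∑ P, kinVar σ j (rotTerm A j P) M N =
      ∑ P, (A M P * kin σ j P N + A N P * kin σ j M P) := by
  -- Every monomial of `prodPart` carries each of the six index slots exactly once, so the rotation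
  -- acts slot by slot. This is why `a'` and `b'` are kept independent of `a` and `b` until the
  -- contraction.
  have hP : ∀ P a a' b b', prodPartVar j (rotTerm A j P) M N a a' b b' =
      A M P * prodPart j P N a a' b b' + A N P * prodPart j M P a a' b b'
      + (A a P * prodPart j M N P a' b b' + A a' P * prodPart j M N a P b b')
      + (A b P * prodPart j M N a a' P b' + A b' P * prodPart j M N a a' b P) := by
    intro P a a' b b'
    simp only [prodPartVar, kinPartVar, rotTerm, prodPart, kinPart]
    ring
  have h1 : ∑ P, ∑ a, ∑ b, (A a P * prodPart j M N P (σ a) b (σ b)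
      + A (σ a) P * prodPart j M N a P b (σ b)) = 0 := by
    rw [Finset.sum_comm]
    conv_lhs => enter [2, a]; rw [Finset.sum_comm]
    rw [Finset.sum_comm]
    exact Finset.sum_eq_zero fun b _ => sum_rot_contract σ hσ A hA
      (fun a a' => prodPart j M N a a' b (σ b))
  have h2 : ∑ P, ∑ a, ∑ b, (A b P * prodPart j M N a (σ a) P (σ b)
      + A (σ b) P * prodPart j M N a (σ a) b P) = 0 := by
    rw [Finset.sum_comm]
    refine Finset.sum_eq_zero fun a _ => ?_
    rw [Finset.sum_comm]
    exact sum_rot_contract σ hσ A hA (fun b b' => prodPart j M N a (σ a) b b')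
  simp only [kinVar, hP]
  simp only [Finset.sum_add_distrib] at h1 h2
  simp only [kin, rotTerm, Finset.sum_add_distrib, mul_add, Finset.mul_sum]
  simp only [mul_left_comm (2 : ℝ)]
  linarith

end Jet

/-! ### Triple sums that vanish after renaming indices -/

section TripleSums

variable {I : Type*} [Fintype I]

/-- The triple sum of `f` vanishes. -/
def Null3 (f : I → I → I → ℝ) : Prop := ∑ a, ∑ b, ∑ c, f a b c = 0

variable {f g : I → I → I → ℝ}

theorem Null3.add (hf : Null3 f) (hg : Null3 g) : Null3 (fun a b c => f a b c + g a b c) := by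
  simp only [Null3, Finset.sum_add_distrib] at *
  rw [hf, hg, add_zero]

theorem null3_sub_iff :
    Null3 (fun a b c => f a b c - g a b c) ↔
      ∑ a, ∑ b, ∑ c, f a b c = ∑ a, ∑ b, ∑ c, g a b c := by
  simp only [Null3, Finset.sum_sub_distrib, sub_eq_zero]

theorem null3_of_fst (h : ∀ b c, ∑ a, f a b c = 0) : Null3 f := by
  rw [Null3, Finset.sum_comm]
  refine Finset.sum_eq_zero fun b _ => ?_
  rw [Finset.sum_comm]
  exact Finset.sum_eq_zero fun c _ => h b c

theorem null3_of_snd (h : ∀ a c, ∑ b, f a b c = 0) : Null3 f := by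
  refine Finset.sum_eq_zero fun a _ => ?_
  rw [Finset.sum_comm]
  exact Finset.sum_eq_zero fun c _ => h a c

/-- This lemma and its five companions, one for each permutation of three dummy indices, express the
freedom to rename dummies, with an optional `η` on each. A renaming becomes a null summand that can
be added to others, so an identity of sums reduces to an identity of summands. -/
theorem null3_abc (e₁ e₂ e₃ : I ≃ I) (f : I → I → I → ℝ) :
    Null3 (fun a b c => f (e₁ a) (e₂ b) (e₃ c) - f a b c) := by
  rw [null3_sub_iff, ← e₁.sum_comp fun a => ∑ b, ∑ c, f a b c]
  refine Finset.sum_congr rfl fun a _ => ?_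
  rw [← e₂.sum_comp fun b => ∑ c, f (e₁ a) b c]
  exact Finset.sum_congr rfl fun b _ => e₃.sum_comp fun c => f (e₁ a) (e₂ b) c

theorem null3_bac (e₁ e₂ e₃ : I ≃ I) (f : I → I → I → ℝ) :
    Null3 (fun a b c => f (e₁ b) (e₂ a) (e₃ c) - f a b c) := by
  have := null3_abc e₁ e₂ e₃ f
  rw [null3_sub_iff] at this ⊢
  rw [← this, Finset.sum_comm]

theorem null3_acb (e₁ e₂ e₃ : I ≃ I) (f : I → I → I → ℝ) :
    Null3 (fun a b c => f (e₁ a) (e₂ c) (e₃ b) - f a b c) := by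
  have := null3_abc e₁ e₂ e₃ f
  rw [null3_sub_iff] at this ⊢
  rw [← this]
  exact Finset.sum_congr rfl fun a _ => Finset.sum_comm

theorem null3_bca (e₁ e₂ e₃ : I ≃ I) (f : I → I → I → ℝ) :
    Null3 (fun a b c => f (e₁ b) (e₂ c) (e₃ a) - f a b c) := by
  have := null3_acb e₁ e₂ e₃ f
  rw [null3_sub_iff] at this ⊢
  rw [← this, Finset.sum_comm]

theorem null3_cab (e₁ e₂ e₃ : I ≃ I) (f : I → I → I → ℝ) :
    Null3 (fun a b c => f (e₁ c) (e₂ a) (e₃ b) - f a b c) := by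
  have := null3_bac e₁ e₂ e₃ f
  rw [null3_sub_iff] at this ⊢
  rw [← this]
  exact Finset.sum_congr rfl fun a _ => Finset.sum_comm

theorem null3_cba (e₁ e₂ e₃ : I ≃ I) (f : I → I → I → ℝ) :
    Null3 (fun a b c => f (e₁ c) (e₂ b) (e₃ a) - f a b c) := by
  have := null3_cab e₁ e₂ e₃ f
  rw [null3_sub_iff] at this ⊢
  rw [← this, Finset.sum_comm]

end TripleSums

/-! ### The linearization of `K` on the non-tensorial terms -/

section Anomaly

variable {I : Type*} [Fintype I] [DecidableEq I]

/-- The relations between the fields and their derivatives at a point: `h` is the generalized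
metric, `s k` its derivative `∂_k H`, `d` the gradient of the dilaton, and `x k m p`, `y k l m p`
are the derivatives `∂_k ∂_m ξ_p`, `∂_k ∂_l ∂_m ξ_p` of the gauge parameter. -/
structure JetRelations (σ : I → I) (h : I → I → ℝ) (s : I → I → I → ℝ) (d : I → ℝ)
    (x : I → I → I → ℝ) (y : I → I → I → I → ℝ) : Prop where
  invol : ∀ a, σ (σ a) = a
  h_symm : ∀ a b, h a b = h b a
  s_symm : ∀ k a b, s k a b = s k b a
  x_symm : ∀ k m p, x k m p = x m k p
  y_symm : ∀ k l m p, y k l m p = y l k m p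
  y_symm' : ∀ k l m p, y k l m p = y k m l p
  h_h : ∀ m n, ∑ a, h m a * h (σ a) n = if n = σ m then 1 else 0
  s_h : ∀ k m n, ∑ a, (s k m a * h (σ a) n + h m a * s k (σ a) n) = 0
  x_s : ∀ m p q r, ∑ a, x (σ a) m p * s a q r = 0
  x_d : ∀ m p, ∑ a, x (σ a) m p * d a = 0
  box_x : ∀ p, ∑ a, x a (σ a) p = 0
  box_y : ∀ m p, ∑ a, y a (σ a) m p = 0

/-- The term labelled by the summation index `c` of the non-tensorial variation of the jet. -/
noncomputable def anomaly (σ : I → I) (h : I → I → ℝ) (s : I → I → I → ℝ) (d : I → ℝ)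
    (x : I → I → I → ℝ) (y : I → I → I → I → ℝ) (c : I) : Jet I where
  h _ _ := 0
  h1 k m n := (x k m (σ c) - x k (σ c) m) * h c n + (x k n (σ c) - x k (σ c) n) * h m c
  h2 k l m n := x k l (σ c) * s c m n
    + ((x l m (σ c) - x l (σ c) m) * s k c n + (x l n (σ c) - x l (σ c) n) * s k m c)
    + ((x k m (σ c) - x k (σ c) m) * s l c n + (x k n (σ c) - x k (σ c) n) * s l m c)
    + ((y k l m (σ c) - y k l (σ c) m) * h c n + (y k l n (σ c) - y k l (σ c) n) * h m c)
  d1 k := -(1 / 2) * x k c (σ c)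
  d2 k l := -(1 / 2) * y k l c (σ c) + x k l (σ c) * d c

variable {σ : I → I} {h : I → I → ℝ} {s : I → I → I → ℝ} {d : I → ℝ}
  {x : I → I → I → ℝ} {y : I → I → I → I → ℝ}

/-- The sum over `a` is `HηH = η`, which identifies `b` with `c`. It removes the pairs of factors
`H` left by terms where the anomaly of `∂H` or `∂∂H` meets an undifferentiated `H`. -/
theorem JetRelations.sum_h_h (C : JetRelations σ h s d x y) (u : I → I → ℝ) :
    ∑ a, ∑ b, ∑ c, h (σ a) (σ b) * h c a * u b c = ∑ c, u c c := by
  rw [Finset.sum_comm]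
  refine Finset.sum_congr rfl fun b _ => ?_
  rw [Finset.sum_comm]
  have : ∀ c, ∑ a, h (σ a) (σ b) * h c a * u b c = if b = c then u b c else 0 := by
    intro c
    have e : ∀ a, h (σ a) (σ b) * h c a * u b c = h c a * h (σ a) (σ b) * u b c := fun a => by ring
    have hi : σ b = σ c ↔ b = c := (Function.Involutive.injective C.invol).eq_iff
    simp only [e, ← Finset.sum_mul, C.h_h, hi]
    split_ifs <;> simp
  simp [this]

/-- The terms bilinear in `∂H` and `∂∂ξ` of the non-tensorial part of the variation of `K_{MN}`,
before symmetrization. -/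
noncomputable def anomalyPart (σ : I → I) (h : I → I → ℝ) (s : I → I → I → ℝ)
    (x : I → I → I → ℝ) (M N a b c : I) : ℝ :=
  1 / 4 * (s M (σ a) b * h (σ c) N * (x a c (σ b) - x a (σ b) c))
  - 1 / 2 * (h (σ a) M * x b a (σ c) * s c (σ b) N)
  + (1 / 4 * (h (σ a) M * s a (σ b) c * (x b N (σ c) - x b (σ c) N))
    - 1 / 2 * (x a M (σ b) * s b (σ a) c * h (σ c) N))

-- The two summands agree only up to null triple sums: renamings of dummies, contractions killed by
-- the strong constraint, and the derivative of `HηH = η`. Listing these with the right coefficients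
-- makes the difference a polynomial identity. The right-hand side is grouped by what follows: terms
-- bilinear in `∂H` and `∂∂ξ`, terms that are already conjugated by `S`, and terms that collapse by
-- `sum_h_h`.
set_option maxHeartbeats 1000000 in
set_option linter.unusedSimpArgs false in
theorem JetRelations.sum_prodPartVar_anomaly (C : JetRelations σ h s d x y)
    {j : Jet I} (hj : j.h = h) (hj1 : j.h1 = s) (hjd : j.d1 = d) (M N : I) :
    ∑ a, ∑ b, ∑ c, j.prodPartVar (anomaly σ h s d x y c) M N a (σ a) b (σ b) =
      ∑ a, ∑ b, ∑ c, (anomalyPart σ h s x M N a b c + anomalyPart σ h s x N M a b c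
        + (h (σ a) M * h (σ b) N + h (σ a) N * h (σ b) M)
          * (1 / 2 * (x a b (σ c) * d c) - 1 / 4 * y a b c (σ c))
        + h (σ a) (σ b) * h c a *
          (1 / 4 * (y b M N (σ c) - y b M (σ c) N + y b N M (σ c) - y b N (σ c) M)
            - 1 / 2 * (d b * (x M N (σ c) - x M (σ c) N + x N M (σ c) - x N (σ c) M)))) := by
  obtain ⟨τ, hτ⟩ : ∃ τ : I ≃ I, ∀ a, τ a = σ a := ⟨⟨σ, σ, C.invol, C.invol⟩, fun _ => rfl⟩
  -- The derivative of `HηH = η`, rewritten so that both terms have the differentiated factor first.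
  have hs1 : ∀ k m n, ∑ a, (s k m a * h (σ a) n + s k n a * h (σ a) m) = 0 := by
    intro k m n
    have e := C.s_h k m n
    rw [Finset.sum_add_distrib] at e ⊢
    rw [← e, add_right_inj, ← Equiv.sum_comp τ]
    refine Finset.sum_congr rfl fun a _ => ?_
    simp only [hτ, C.invol]
    rw [C.s_symm k n, C.h_symm m, mul_comm]
  have hs2 : ∀ k m n, ∑ a, (s k m (σ a) * h a n + s k n (σ a) * h a m) = 0 := by
    intro k m n
    rw [← hs1 k m n, ← Equiv.sum_comp τ]
    exact Finset.sum_congr rfl fun a _ => by simp only [hτ, C.invol]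
  -- Renamings of the summation indices and contractions that vanish by the relations `C`.
  have R := fun M N : I =>
      (null3_acb (.refl I) (.refl I) τ (fun a b c =>
        (1 / 8) * h (σ a) M * y b a (σ c) (σ b) * h c N)).add <|
      (null3_cba τ (.refl I) τ (fun a b c => -(1 / 4) * h (σ a) (σ b) * y a b (σ c) M * h c N
        + (1 / 4) * h (σ a) (σ b) * y b M (σ c) a * h N c
        - (1 / 8) * h (σ a) M * y b a (σ c) (σ b) * h c N)).add <|
      (null3_bca (.refl I) (.refl I) τ (fun a b c =>
        (1 / 8) * h (σ a) M * y b a (σ c) (σ b) * h c N)).add <|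
      ((null3_of_snd (f := fun a b c => (1 / 4) * h (σ a) M * h c N * (y b (σ b) a (σ c)))
        (fun _ _ => by simp only [Finset.sum_add_distrib, Finset.sum_sub_distrib,
          ← Finset.mul_sum, C.x_s, C.x_d, C.box_x, C.box_y, hs1, hs2, mul_zero, add_zero,
          sub_zero]))).add <|
      (null3_bac (.refl I) (.refl I) (.refl I) (fun a b c =>
        -(1 / 2) * d a * h (σ a) (σ b) * x b M (σ c) * h c N)).add <|
      (null3_acb (.refl I) (.refl I) τ (fun a b c =>
        -(1 / 4) * d b * h (σ a) M * x a (σ c) (σ b) * h c N)).add <|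
      (null3_cba τ (.refl I) τ (fun a b c => -(1 / 2) * d b * h (σ a) (σ b) * x M (σ c) a * h N c
        + (1 / 4) * d b * h (σ a) M * x a (σ c) (σ b) * h c N)).add <|
      (null3_bca (.refl I) (.refl I) τ (fun a b c =>
        -(1 / 4) * d b * h (σ a) M * x a (σ c) (σ b) * h c N)).add <|
      (null3_bca (.refl I) τ τ (fun a b c =>
        (1 / 2) * d a * h (σ a) (σ b) * x b (σ c) M * h c N)).add <|
      ((null3_of_snd (f := fun a b c => -(1 / 2) * h (σ a) M * h c N * (x (σ b) a (σ c) * d b))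
        (fun _ _ => by simp only [Finset.sum_add_distrib, Finset.sum_sub_distrib,
          ← Finset.mul_sum, C.x_s, C.x_d, C.box_x, C.box_y, hs1, hs2, mul_zero, add_zero,
          sub_zero]))).add <|
      (null3_abc τ (.refl I) (.refl I) (fun a b c =>
        (1 / 4) * x M (σ a) (σ c) * h c (σ b) * s b N a
        + (1 / 4) * s b (σ a) c * x M N (σ c) * h (σ b) a
        - (1 / 4) * s b (σ a) c * x M (σ c) N * h (σ b) a)).add <|
      (null3_bac (.refl I) (.refl I) (.refl I) (fun a b c =>
        (1 / 8) * x M (σ a) (σ c) * h c (σ b) * s N a b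
        + (1 / 4) * s a (σ a) (σ b) * x b M (σ c) * h c N
        + (1 / 4) * h (σ a) (σ b) * x b (σ c) M * s a c N
        - (1 / 4) * x b (σ c) (σ a) * h c M * s a (σ b) N)).add <|
      (null3_cba (.refl I) (.refl I) (.refl I) (fun a b c =>
        -(1 / 8) * x M (σ a) (σ c) * h a (σ b) * s N c b)).add <|
      (null3_acb (.refl I) (.refl I) τ (fun a b c =>
        -(1 / 8) * x a (σ c) (σ b) * h (σ a) c * s b M N
        + (1 / 4) * x M (σ c) (σ b) * h (σ a) c * s b N a
        + (1 / 4) * x b (σ c) (σ b) * h (σ a) c * s M N a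
        + (1 / 4) * h (σ a) M * x b (σ c) (σ b) * s a c N)).add <|
      (null3_bac τ (.refl I) (.refl I) (fun a b c =>
        (1 / 4) * x M (σ a) (σ c) * h a (σ b) * s N c b
        + (1 / 4) * x M (σ a) (σ c) * h c (σ b) * s b N a)).add <|
      (null3_cba (.refl I) (.refl I) τ (fun a b c =>
        -(1 / 8) * x a (σ c) (σ a) * h c (σ b) * s b M N
        - (1 / 4) * x M (σ a) (σ c) * h c (σ b) * s b N a
        + (1 / 2) * x M (σ c) (σ b) * h (σ a) N * s b c a
        - (1 / 4) * x b (σ a) (σ c) * h c (σ b) * s M N a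
        + (3 / 4) * x b (σ c) (σ a) * h c M * s a (σ b) N
        + (1 / 4) * x b (σ c) (σ a) * h c (σ b) * s M N a)).add <|
      (null3_acb (.refl I) τ τ (fun a b c =>
        -(1 / 4) * h (σ a) (σ b) * x b (σ c) M * s a c N)).add <|
      (null3_bac τ (.refl I) τ (fun a b c => (1 / 4) * s M (σ a) (σ b) * x b a (σ c) * h N c
        - (1 / 4) * s M (σ a) (σ b) * x b (σ c) a * h N c)).add <|
      (null3_bac τ τ (.refl I) (fun a b c =>
        -(1 / 4) * x M (σ a) (σ c) * h c (σ b) * s N a b)).add <|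
      (null3_cba τ (.refl I) τ (fun a b c =>
        (1 / 4) * s b (σ a) (σ b) * x M (σ c) a * h N c)).add <|
      (null3_acb τ τ τ (fun a b c => -(1 / 4) * s M (σ a) (σ b) * x b (σ c) N * h c a)).add <|
      (null3_cab (.refl I) (.refl I) (.refl I) (fun a b c =>
        -(1 / 8) * x M (σ a) (σ c) * h a (σ b) * s N c b)).add <|
      (null3_bca (.refl I) τ (.refl I) (fun a b c =>
        (1 / 4) * h (σ a) (σ b) * x b M (σ c) * s a c N)).add <|
      (null3_bca (.refl I) τ τ (fun a b c => -(1 / 4) * s a (σ a) (σ b) * x b (σ c) M * h c N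
        - (1 / 4) * h (σ a) (σ b) * x b (σ c) M * s a c N
        - (1 / 4) * x b (σ c) (σ a) * h c M * s a (σ b) N)).add <|
      ((null3_of_fst (f := fun a b c => -(1 / 8) * h c (σ b) * s b M N * (x a (σ a) (σ c))
        + (1 / 4) * h c M * (x (σ a) b (σ c) * s a (σ b) N))
        (fun _ _ => by simp only [Finset.sum_add_distrib, Finset.sum_sub_distrib,
          ← Finset.mul_sum, C.x_s, C.x_d, C.box_x, C.box_y, hs1, hs2, mul_zero, add_zero,
          sub_zero]))).add <|
      ((null3_of_snd (f := fun a b c => -(1 / 8) * h (σ a) c * (x (σ b) a (σ c) * s b M N)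
        - (1 / 4) * h (σ a) c * (x (σ b) M (σ c) * s b N a)
        + (1 / 4) * h (σ a) c * s M N a * (x b (σ b) (σ c))
        + (1 / 4) * h c N * (x (σ b) a (σ c) * s b (σ a) M)
        + (1 / 4) * h (σ a) M * (x (σ b) a (σ c) * s b c N)
        + (1 / 4) * h (σ a) M * s a c N * (x b (σ b) (σ c)))
        (fun _ _ => by simp only [Finset.sum_add_distrib, Finset.sum_sub_distrib,
          ← Finset.mul_sum, C.x_s, C.x_d, C.box_x, C.box_y, hs1, hs2, mul_zero, add_zero,
          sub_zero]))).add <|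
      ((null3_of_fst (f := fun a b c =>
        (1 / 2) * x M (σ c) (σ b) * (s b N a * h (σ a) c + s b c a * h (σ a) N))
        (fun _ _ => by simp only [Finset.sum_add_distrib, Finset.sum_sub_distrib,
          ← Finset.mul_sum, C.x_s, C.x_d, C.box_x, C.box_y, hs1, hs2, mul_zero, add_zero,
          sub_zero]))).add <|
      ((null3_of_fst (f := fun a b c =>
        (1 / 4) * x M N (σ c) * (s b (σ b) (σ a) * h a c + s b c (σ a) * h a (σ b)))
        (fun _ _ => by simp only [Finset.sum_add_distrib, Finset.sum_sub_distrib,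
          ← Finset.mul_sum, C.x_s, C.x_d, C.box_x, C.box_y, hs1, hs2, mul_zero, add_zero,
          sub_zero]))).add <|
      ((null3_of_fst (f := fun a b c =>
        -(1 / 4) * x M (σ c) N * (s b (σ b) (σ a) * h a c + s b c (σ a) * h a (σ b)))
        (fun _ _ => by simp only [Finset.sum_add_distrib, Finset.sum_sub_distrib,
          ← Finset.mul_sum, C.x_s, C.x_d, C.box_x, C.box_y, hs1, hs2, mul_zero, add_zero,
          sub_zero])))
  -- The variation of `⅛ ∂_M H^{KL} ∂_N H_{KL}` becomes termwise symmetric in `M, N` only after the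
  -- raised pair is moved to the other factor. This needs one renaming; all the others come in `M ↔
  -- N` pairs, as `R M N` and `R N M`.
  have R0 := null3_abc τ τ (.refl I) (fun a b c => -(1 / 8) * s M (σ a) (σ b) *
    ((x N a (σ c) - x N (σ c) a) * h c b + (x N b (σ c) - x N (σ c) b) * h a c))
  rw [← null3_sub_iff]
  have R' := (R0.add (R M N)).add (R N M)
  unfold Null3 at R' ⊢
  refine Eq.trans ?_ R'
  refine Finset.sum_congr rfl fun a _ => Finset.sum_congr rfl fun b _ =>
    Finset.sum_congr rfl fun c _ => ?_
  -- The symmetry relations serve as ordered rewrite rules that bring every factor to a normal form,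
  -- after which a polynomial identity remains.
  simp only [hτ, Equiv.refl_apply, C.invol, Jet.prodPartVar, Jet.kinPartVar, anomaly, anomalyPart,
    hj, hj1, hjd, C.h_symm, C.s_symm, C.x_symm, C.y_symm, C.y_symm']
  ring

end Anomaly

/-! ### Conjugation by `S`, and the form `T + Sᵗ T S` -/

section Conjugation

variable {I : Type*} [Fintype I] {σ : I → I} {h : I → I → ℝ}
  {s : I → I → I → ℝ} {d : I → ℝ} {x : I → I → I → ℝ} {y : I → I → I → I → ℝ}

/-- The matrix `Sᵗ T S`, where `S` has the components `h (σ M) N`. -/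
noncomputable def conjS (σ : I → I) (h T : I → I → ℝ) (M N : I) : ℝ :=
  ∑ b, (∑ a, h (σ a) M * T a b) * h (σ b) N

theorem conjS_add (T U : I → I → ℝ) (M N : I) :
    conjS σ h (fun a b => T a b + U a b) M N = conjS σ h T M N + conjS σ h U M N := by
  simp only [conjS, mul_add, add_mul, Finset.sum_add_distrib]

theorem conjS_eq_sum (T : I → I → ℝ) (M N : I) :
    conjS σ h T M N = ∑ a, ∑ b, h (σ a) M * h (σ b) N * T a b := by
  rw [Finset.sum_comm]
  simp only [conjS, Finset.sum_mul]
  exact Finset.sum_congr rfl fun b _ => Finset.sum_congr rfl fun a _ => by ring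

theorem conjS_swap (T : I → I → ℝ) (M N : I) :
    conjS σ h (fun a b => T b a) M N = conjS σ h T N M := by
  rw [conjS_eq_sum, conjS_eq_sum, Finset.sum_comm]
  exact Finset.sum_congr rfl fun a _ => Finset.sum_congr rfl fun b _ => by ring

variable [DecidableEq I]

theorem JetRelations.sum_sum_h_h (C : JetRelations σ h s d x y) (v : I → ℝ) (N : I) :
    ∑ b, ∑ k, h (σ k) b * h (σ b) N * v k = v N := by
  rw [Finset.sum_comm]
  simp only [← Finset.sum_mul, C.h_h, C.invol]
  simp

/-- In matrix form, `Sᵗ (V S) S = Sᵗ V` since `S² = 1`: conjugation removes a factor `S` on the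
right and creates one on the left. -/
theorem JetRelations.conjS_mul_right (C : JetRelations σ h s d x y) (v : I → I → ℝ) (M N : I) :
    conjS σ h (fun a b => ∑ k, h (σ k) b * v a k) M N = ∑ a, h (σ a) M * v a N := by
  rw [conjS_eq_sum]
  refine Finset.sum_congr rfl fun a _ => ?_
  rw [← C.sum_sum_h_h (v a) N, Finset.mul_sum]
  refine Finset.sum_congr rfl fun b _ => ?_
  rw [Finset.mul_sum, Finset.mul_sum]
  exact Finset.sum_congr rfl fun k _ => by ring

theorem JetRelations.conjS_mul_left (C : JetRelations σ h s d x y) (w : I → I → ℝ) (M N : I) :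
    conjS σ h (fun a b => ∑ p, h (σ p) a * w p b) M N = ∑ b, h (σ b) N * w M b :=
  (conjS_swap (fun b a => ∑ p, h (σ p) a * w p b) M N).trans
    (C.conjS_mul_right (fun b p => w p b) N M)

/-- The tensor `T_{MN}` before symmetrization, as a function of the jets. -/
noncomputable def tPart (σ : I → I) (h : I → I → ℝ) (s : I → I → I → ℝ) (d : I → ℝ)
    (x : I → I → I → ℝ) (y : I → I → I → I → ℝ) (M N : I) : ℝ :=
  ∑ c, (1 / 2 * (x M N (σ c) * d c) - 1 / 4 * y M N c (σ c))
  + ∑ k, h (σ k) N * ∑ l, ∑ p, 1 / 4 * (s M (σ l) p * (x l k (σ p) - x l (σ p) k))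
  + ∑ p, h (σ p) M * ∑ l, ∑ q, -(1 / 2) * (x l p (σ q) * s q (σ l) N)

/-- The first two terms of `anomalyPart` are the terms of `T` with one factor `S`; the last two are
their conjugates, where that factor has changed sides. Only the terms without `S` acquire two
factors on conjugation. -/
theorem JetRelations.tPart_add_conjS (C : JetRelations σ h s d x y) (M N : I) :
    tPart σ h s d x y M N + conjS σ h (tPart σ h s d x y) M N =
      ∑ c, (1 / 2 * (x M N (σ c) * d c) - 1 / 4 * y M N c (σ c))
      + ∑ a, ∑ b, ∑ c, (anomalyPart σ h s x M N a b c
        + h (σ a) M * h (σ b) N * (1 / 2 * (x a b (σ c) * d c) - 1 / 4 * y a b c (σ c))) := by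
  have e : conjS σ h (tPart σ h s d x y) M N =
      ∑ a, ∑ b, h (σ a) M * h (σ b) N *
        ∑ c, (1 / 2 * (x a b (σ c) * d c) - 1 / 4 * y a b c (σ c))
      + ∑ a, h (σ a) M * ∑ l, ∑ p, 1 / 4 * (s a (σ l) p * (x l N (σ p) - x l (σ p) N))
      + ∑ b, h (σ b) N * ∑ l, ∑ q, -(1 / 2) * (x l M (σ q) * s q (σ l) b) := by
    have e1 := C.conjS_mul_right
      (fun a k => ∑ l, ∑ p, 1 / 4 * (s a (σ l) p * (x l k (σ p) - x l (σ p) k))) M N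
    have e2 := C.conjS_mul_left
      (fun p b => ∑ l, ∑ q, -(1 / 2) * (x l p (σ q) * s q (σ l) b)) M N
    rw [← e1, ← e2, ← conjS_eq_sum, ← conjS_add, ← conjS_add]
    rfl
  have e1 : ∑ k, h (σ k) N * ∑ l, ∑ p, 1 / 4 * (s M (σ l) p * (x l k (σ p) - x l (σ p) k)) =
      ∑ a, ∑ b, ∑ c, 1 / 4 * (s M (σ a) b * h (σ c) N * (x a c (σ b) - x a (σ b) c)) := by
    simp only [Finset.mul_sum]
    rw [Finset.sum_comm]
    refine Finset.sum_congr rfl fun a _ => ?_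
    rw [Finset.sum_comm]
    exact Finset.sum_congr rfl fun b _ => Finset.sum_congr rfl fun c _ => by ring
  have e2 : ∑ b, h (σ b) N * ∑ l, ∑ q, -(1 / 2) * (x l M (σ q) * s q (σ l) b) =
      ∑ a, ∑ b, ∑ c, -(1 / 2) * (x a M (σ b) * s b (σ a) c * h (σ c) N) := by
    simp only [Finset.mul_sum]
    rw [Finset.sum_comm]
    refine Finset.sum_congr rfl fun a _ => ?_
    rw [Finset.sum_comm]
    exact Finset.sum_congr rfl fun b _ => Finset.sum_congr rfl fun c _ => by ring
  rw [e, e2, tPart, e1, add_assoc, add_assoc, add_right_inj]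
  simp only [Finset.mul_sum, ← Finset.sum_add_distrib]
  refine Finset.sum_congr rfl fun a _ => Finset.sum_congr rfl fun b _ =>
    Finset.sum_congr rfl fun c _ => ?_
  rw [anomalyPart]
  ring

/-- The non-tensorial part of the variation of `K`. -/
theorem JetRelations.sum_kinVar_anomaly (C : JetRelations σ h s d x y)
    {j : Jet I} (hj : j.h = h) (hj1 : j.h1 = s) (hjd : j.d1 = d) (M N : I) :
    ∑ c, j.kinVar σ (anomaly σ h s d x y c) M N =
      tPart σ h s d x y M N + tPart σ h s d x y N M
      + conjS σ h (fun a b => tPart σ h s d x y a b + tPart σ h s d x y b a) M N := by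
  have hc : ∑ c, ∑ a, ∑ b, j.prodPartVar (anomaly σ h s d x y c) M N a (σ a) b (σ b) =
      ∑ a, ∑ b, ∑ c, j.prodPartVar (anomaly σ h s d x y c) M N a (σ a) b (σ b) := by
    rw [Finset.sum_comm]
    exact Finset.sum_congr rfl fun a _ => Finset.sum_comm
  -- Contracting two derivatives, or a derivative of `ξ` with one of `d`, gives zero by the strong
  -- constraint; only contractions of a derivative with the index of `ξ` survive in `hE`.
  have hz1 : ∀ P Q, ∑ c, y c P (σ c) Q = 0 := by
    intro P Q
    rw [← C.box_y P Q]
    exact Finset.sum_congr rfl fun c _ => C.y_symm' _ _ _ _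
  have hz2 : ∀ P Q, ∑ c, d c * x P (σ c) Q = 0 := by
    intro P Q
    rw [← C.x_d P Q]
    exact Finset.sum_congr rfl fun c _ => by rw [C.x_symm P]; ring
  have hy : ∀ P Q R, y P Q R (σ R) = y R P Q (σ R) := fun P Q R => by
    rw [C.y_symm', C.y_symm]
  have hE : ∑ c, (1 / 4 * (y c M N (σ c) - y c M (σ c) N + y c N M (σ c) - y c N (σ c) M)
      - 1 / 2 * (d c * (x M N (σ c) - x M (σ c) N + x N M (σ c) - x N (σ c) M))) =
      ∑ c, (1 / 2 * y M N c (σ c) - x M N (σ c) * d c) := by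
    have : ∀ c, 1 / 4 * (y c M N (σ c) - y c M (σ c) N + y c N M (σ c) - y c N (σ c) M)
      - 1 / 2 * (d c * (x M N (σ c) - x M (σ c) N + x N M (σ c) - x N (σ c) M)) =
      (1 / 2 * y M N c (σ c) - x M N (σ c) * d c)
      + (-(1 / 4) * y c M (σ c) N + -(1 / 4) * y c N (σ c) M
        + 1 / 2 * (d c * x M (σ c) N) + 1 / 2 * (d c * x N (σ c) M)) := by
      intro c
      rw [hy M N c, C.x_symm N M, C.y_symm' c N M]
      ring
    simp only [this]
    rw [Finset.sum_add_distrib]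
    simp only [Finset.sum_add_distrib, ← Finset.mul_sum, hz1, hz2]
    ring
  have hx : ∑ c, (1 / 2 * (x N M (σ c) * d c) - 1 / 4 * y N M c (σ c)) =
      ∑ c, (1 / 2 * (x M N (σ c) * d c) - 1 / 4 * y M N c (σ c)) :=
    Finset.sum_congr rfl fun c _ => by rw [C.x_symm N M, C.y_symm N M]
  have e1 := C.tPart_add_conjS M N
  have e2 := C.tPart_add_conjS N M
  have hsw := conjS_swap (σ := σ) (h := h) (tPart σ h s d x y) M N
  have split : ∀ f g u w : I → I → I → ℝ, ∑ a, ∑ b, ∑ c, (f a b c + g a b c + u a b c + w a b c) =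
      ∑ a, ∑ b, ∑ c, f a b c + ∑ a, ∑ b, ∑ c, g a b c + ∑ a, ∑ b, ∑ c, u a b c
      + ∑ a, ∑ b, ∑ c, w a b c := by
    intro f g u w
    simp only [Finset.sum_add_distrib]
  simp only [Jet.kinVar]
  rw [Finset.sum_add_distrib, hc, C.sum_prodPartVar_anomaly hj hj1 hjd, split, C.sum_h_h
    (fun b c => 1 / 4 * (y b M N (σ c) - y b M (σ c) N + y b N M (σ c) - y b N (σ c) M)
      - 1 / 2 * (d b * (x M N (σ c) - x M (σ c) N + x N M (σ c) - x N (σ c) M))), hE,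
    conjS_add, hsw]
  rw [hx] at e2
  simp only [Finset.sum_add_distrib] at e1 e2
  simp only [add_mul, Finset.sum_add_distrib, anomaly]
  -- The variation of `2 ∂_M ∂_N d` contributes four times the terms of `T_{MN}` without `S`, and
  -- the collapsed terms of `hE` remove two of these. The two that remain belong to `T_{MN}` and
  -- `T_{NM}` before symmetrization.
  have hd : ∑ c, 2 * (-(1 / 2) * y M N c (σ c) + x M N (σ c) * d c)
      + ∑ c, (1 / 2 * y M N c (σ c) - x M N (σ c) * d c) =
      2 * ∑ c, (1 / 2 * (x M N (σ c) * d c) - 1 / 4 * y M N c (σ c)) := by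
    rw [← Finset.sum_add_distrib, Finset.mul_sum]
    exact Finset.sum_congr rfl fun c _ => by ring
  linear_combination hd - e1 - e2

end Conjugation

/-! ### The jets of the fields, and `K` evaluated on them -/

theorem sum_bar (f : Idx D → ℝ) : ∑ a, f (bar a) = ∑ a, f a :=
  Equiv.sum_comp (Equiv.sumComm (Fin D) (Fin D)) f

/-- The jet of the fields `H` and `d` at the point `X`. -/
noncomputable def fieldJet (H : TensorField D) (d : Pt D → ℝ) (X : Pt D) : Jet (Idx D) where
  h a b := H X a b
  h1 k a b := pd k (fun Y => H Y a b) X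
  h2 k l a b := pd k (pd l (fun Y => H Y a b)) X
  d1 k := pd k d X
  d2 k l := pd k (pd l d) X

/-- The derivative in the direction `P` of the jet of the fields. -/
noncomputable def fieldJetDeriv (H : TensorField D) (d : Pt D → ℝ) (X : Pt D) (P : Idx D) :
    Jet (Idx D) where
  h a b := pd P (fun Y => H Y a b) X
  h1 k a b := pd P (pd k (fun Y => H Y a b)) X
  h2 k l a b := pd P (pd k (pd l (fun Y => H Y a b))) X
  d1 k := pd P (pd k d) X
  d2 k l := pd P (pd k (pd l d)) X

section Smooth

variable {H : TensorField D} {d : Pt D → ℝ}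

theorem contDiff_kinPart (hH : ∀ M N, ContDiff ℝ ∞ (fun X => H X M N)) (hd : ContDiff ℝ ∞ d)
    (M N a a' b b' : Idx D) :
    ContDiff ℝ ∞ (fun X => (fieldJet H d X).kinPart M N a a' b b') :=
  (((contDiff_const.mul (((hH _ _).pd _).mul ((hH _ _).pd _))).add
    (contDiff_const.mul ((((((hH _ _).pd _).mul ((hH _ _).pd _)).add
      ((hH _ _).mul (((hH _ _).pd _).pd _))).add (((hH _ _).pd _).mul ((hH _ _).pd _))).add
        ((hH _ _).mul (((hH _ _).pd _).pd _))))).sub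
    ((hd.pd _).mul (((hH _ _).mul ((hH _ _).pd _)).add ((hH _ _).mul ((hH _ _).pd _)))))

theorem contDiff_prodPart (hH : ∀ M N, ContDiff ℝ ∞ (fun X => H X M N)) (hd : ContDiff ℝ ∞ d)
    (M N a a' b b' : Idx D) :
    ContDiff ℝ ∞ (fun X => (fieldJet H d X).prodPart M N a a' b b') :=
  (((contDiff_const.mul (((hH _ _).pd _).mul ((hH _ _).pd _))).sub
    (contDiff_const.mul ((((hH _ _).pd _).mul ((hH _ _).pd _)).add
      ((hH _ _).mul (((hH _ _).pd _).pd _))))).add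
    (contDiff_const.mul (((hd.pd _).mul (hH _ _)).mul ((hH _ _).pd _)))).add
    (contDiff_const.mul ((contDiff_kinPart hH hd M N a a' b b').add
      (contDiff_kinPart hH hd N M a a' b b')))

theorem contDiff_kin (hH : ∀ M N, ContDiff ℝ ∞ (fun X => H X M N)) (hd : ContDiff ℝ ∞ d)
    (M N : Idx D) : ContDiff ℝ ∞ (fun X => (fieldJet H d X).kin bar M N) :=
  (contDiff_const.mul ((hd.pd _).pd _)).add (ContDiff.sum fun a _ => ContDiff.sum fun b _ =>
    contDiff_prodPart hH hd M N a (bar a) b (bar b))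

/-- `(∂_L - 2 ∂_L d)` applied to a contraction of two smooth fields. -/
theorem dilDiv_sum_mul {u v : Idx D → Idx D → Pt D → ℝ} (hu : ∀ L K, ContDiff ℝ ∞ (u L K))
    (hv : ∀ L K, ContDiff ℝ ∞ (v L K)) (X : Pt D) :
    dilDiv d (fun L Y => ∑ K, u L K Y * v L K Y) X =
      ∑ L, ∑ K, (pd L (u L K) X * v L K X + u L K X * pd L (v L K) X
        - 2 * pd L d X * (u L K X * v L K X)) := by
  simp only [dilDiv]
  refine Finset.sum_congr rfl fun L _ => ?_
  rw [pd_sum _ fun K => (hu L K).mul (hv L K), Finset.mul_sum, ← Finset.sum_sub_distrib]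
  exact Finset.sum_congr rfl fun K _ => by rw [pd_mul (hu L K) (hv L K)]

theorem kinAux_eq (hH : ∀ M N, ContDiff ℝ ∞ (fun X => H X M N)) (X : Pt D) (M N : Idx D) :
    kinAux H d X M N =
      ∑ a, ∑ b, (fieldJet H d X).kinPart M N a (bar a) b (bar b) := by
  have e : dilDiv d (fun L Y => ∑ K,
      (upMat H Y K L * pd M (fun Z => H Z N K) Y
        + sMat H Y K M * pd K (fun Z => sMat H Z L N) Y)) X =
      dilDiv d (fun L Y => ∑ K, H Y (bar K) (bar L) * pd M (fun Z => H Z N K) Y) X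
      + dilDiv d (fun L Y => ∑ K, H Y (bar K) M * pd K (fun Z => H Z (bar L) N) Y) X := by
    simp only [dilDiv, ← Finset.sum_add_distrib, upMat_apply, sMat_apply]
    refine Finset.sum_congr rfl fun L _ => ?_
    simp only [Finset.sum_add_distrib]
    rw [pd_add (ContDiff.sum fun K _ => (hH _ _).mul ((hH _ _).pd _))
      (ContDiff.sum fun K _ => (hH _ _).mul ((hH _ _).pd _))]
    ring
  rw [kinAux, e, dilDiv_sum_mul (fun L K => hH _ _) (fun L K => (hH _ _).pd _),
    dilDiv_sum_mul (fun L K => hH _ _) (fun L K => (hH _ _).pd _)]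
  simp only [← Finset.sum_add_distrib]
  conv_lhs => enter [2, 2]; rw [Finset.sum_comm]
  simp only [Finset.mul_sum, ← Finset.sum_add_distrib, upMat_apply]
  refine Finset.sum_congr rfl fun a _ => Finset.sum_congr rfl fun b _ => ?_
  simp only [Jet.kinPart, fieldJet]
  ring

theorem kField_eq (hH : ∀ M N, ContDiff ℝ ∞ (fun X => H X M N)) (X : Pt D) (M N : Idx D) :
    kField H d X M N = (fieldJet H d X).kin bar M N := by
  simp only [kField, Matrix.of_apply, kinAux_eq hH, upMat_apply]
  rw [dilDiv_sum_mul (fun L K => hH _ _) (fun L K => (hH _ _).pd _), Jet.kin]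
  have e : ∀ a b : Idx D, (fieldJet H d X).prodPart M N a (bar a) b (bar b) =
      1 / 8 * (pd M (fun Y => H Y (bar a) (bar b)) X * pd N (fun Y => H Y a b) X)
      - 1 / 4 * (pd a (fun Y => H Y (bar a) (bar b)) X * pd b (fun Y => H Y M N) X
        + H X (bar a) (bar b) * pd a (pd b (fun Y => H Y M N)) X
        - 2 * pd a d X * (H X (bar a) (bar b) * pd b (fun Y => H Y M N) X))
      + 1 / 2 * ((fieldJet H d X).kinPart M N a (bar a) b (bar b)
        + (fieldJet H d X).kinPart N M a (bar a) b (bar b)) := by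
    intro a b
    simp only [Jet.prodPart, fieldJet]
    ring
  simp only [e, Finset.sum_add_distrib, Finset.sum_sub_distrib, ← Finset.mul_sum]
  rw [show (fieldJet H d X).d2 M N = pd M (pd N d) X from rfl]
  ring

theorem hasDeriv_fieldJet (hH : ∀ M N, ContDiff ℝ ∞ (fun X => H X M N)) (hd : ContDiff ℝ ∞ d)
    (X : Pt D) (P : Idx D) :
    Jet.HasDeriv (fun t : ℝ => fieldJet H d (X + t • Pi.single P 1)) (fieldJetDeriv H d X P) where
  h a b := hasDerivAt_pd (hH a b) P X
  h1 k a b := hasDerivAt_pd ((hH a b).pd k) P X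
  h2 k l a b := hasDerivAt_pd (((hH a b).pd l).pd k) P X
  d1 k := hasDerivAt_pd (hd.pd k) P X
  d2 k l := hasDerivAt_pd ((hd.pd l).pd k) P X

/-- Chain rule along the line `X + t e_P`. The transport term of the Lie derivative is thereby a
value of the same linearization as the gauge variation. -/
theorem pd_kField (hH : ∀ M N, ContDiff ℝ ∞ (fun X => H X M N)) (hd : ContDiff ℝ ∞ d)
    (X : Pt D) (P M N : Idx D) :
    pd P (fun Y => kField H d Y M N) X =
      (fieldJet H d X).kinVar bar (fieldJetDeriv H d X P) M N := by
  simp only [kField_eq hH]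
  have := (hasDeriv_fieldJet hH hd X P).kin bar M N
  simp only [zero_smul, add_zero] at this
  exact pd_eq_of_hasDerivAt (contDiff_kin hH hd M N) this

end Smooth

/-! ### Varying the fields: affine curves of jets -/

section Variation

variable {H H' : TensorField D} {d d' : Pt D → ℝ}

theorem pd_add_smul {f g : Pt D → ℝ} (hf : ContDiff ℝ ∞ f) (hg : ContDiff ℝ ∞ g) (ε : ℝ)
    (M : Idx D) : pd M (fun Y => f Y + ε * g Y) = fun Y => pd M f Y + ε * pd M g Y := by
  rw [pd_add hf (contDiff_const.mul hg), pd_const_mul hg]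

theorem hasDerivAt_add_mul (a b : ℝ) : HasDerivAt (fun ε : ℝ => a + ε * b) b 0 := by
  simpa using ((hasDerivAt_id (0 : ℝ)).mul_const b).const_add a

theorem hasDeriv_fieldJet_add_smul (hH : ∀ M N, ContDiff ℝ ∞ (fun X => H X M N))
    (hH' : ∀ M N, ContDiff ℝ ∞ (fun X => H' X M N)) (hd : ContDiff ℝ ∞ d)
    (hd' : ContDiff ℝ ∞ d') (X : Pt D) :
    Jet.HasDeriv (fun ε : ℝ => fieldJet (H + ε • H') (d + ε • d') X) (fieldJet H' d' X) := by
  have e : ∀ (ε : ℝ) a b, (fun Y => (H + ε • H') Y a b) = fun Y => H Y a b + ε * H' Y a b :=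
    fun ε a b => rfl
  have e' : ∀ ε : ℝ, d + ε • d' = fun Y => d Y + ε * d' Y := fun ε => rfl
  constructor
  · exact fun a b => hasDerivAt_add_mul _ _
  · intro k a b
    simp only [fieldJet, e, pd_add_smul (hH _ _) (hH' _ _)]
    exact hasDerivAt_add_mul _ _
  · intro k l a b
    simp only [fieldJet, e, pd_add_smul (hH _ _) (hH' _ _),
      pd_add_smul ((hH _ _).pd _) ((hH' _ _).pd _)]
    exact hasDerivAt_add_mul _ _
  · intro k
    simp only [fieldJet, e', pd_add_smul hd hd']
    exact hasDerivAt_add_mul _ _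
  · intro k l
    simp only [fieldJet, e', pd_add_smul hd hd', pd_add_smul (hd.pd _) (hd'.pd _)]
    exact hasDerivAt_add_mul _ _

theorem hasDerivAt_kField (hH : ∀ M N, ContDiff ℝ ∞ (fun X => H X M N))
    (hH' : ∀ M N, ContDiff ℝ ∞ (fun X => H' X M N)) (hd : ContDiff ℝ ∞ d)
    (hd' : ContDiff ℝ ∞ d') (X : Pt D) (M N : Idx D) :
    HasDerivAt (fun ε : ℝ => kField (H + ε • H') (d + ε • d') X M N)
      ((fieldJet H d X).kinVar bar (fieldJet H' d' X) M N) 0 := by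
  have e : ∀ ε : ℝ, kField (H + ε • H') (d + ε • d') X M N =
      (fieldJet (H + ε • H') (d + ε • d') X).kin bar M N := fun ε =>
    kField_eq (fun M N => (hH M N).add (contDiff_const.mul (hH' M N))) X M N
  simp only [e]
  have := (hasDeriv_fieldJet_add_smul hH hH' hd hd' X).kin bar M N
  simpa only [zero_smul, add_zero] using this

end Variation

theorem box_eq (f : Pt D → ℝ) (X : Pt D) : box f X = ∑ a, pd a (pd (bar a) f) X := by
  simp only [box, pdUp_eq]
  rw [← sum_bar]
  simp only [bar_bar]

theorem box_mul {f g : Pt D → ℝ} (hf : ContDiff ℝ ∞ f) (hg : ContDiff ℝ ∞ g) (X : Pt D) :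
    box (fun Y => f Y * g Y) X =
      box f X * g X + f X * box g X + 2 * ∑ a, pd (bar a) f X * pd a g X := by
  have e : ∀ a, pd a (pd (bar a) (fun Y => f Y * g Y)) X =
      pd a (pd (bar a) f) X * g X + f X * pd a (pd (bar a) g) X + pd (bar a) f X * pd a g X
      + pd a f X * pd (bar a) g X := by
    intro a
    rw [pd_mul hf hg, pd_add ((hf.pd _).mul hg) (hf.mul (hg.pd _)), pd_mul (hf.pd _) hg,
      pd_mul hf (hg.pd _)]
    ring
  have e' : ∑ a, pd a f X * pd (bar a) g X = ∑ a, pd (bar a) f X * pd a g X := by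
    rw [← sum_bar]
    simp only [bar_bar]
  simp only [box_eq, e, Finset.sum_add_distrib, e', ← Finset.sum_mul, ← Finset.mul_sum]
  ring

/-! ### Pointwise consequences of the strong constraint -/

section Constraints

variable {H : TensorField D} {d : Pt D → ℝ} {ξ : VecField D}

theorem Admissible.contDiff (h : Admissible H d ξ) {A : Pt D → ℝ} (hA : IsField H d ξ A) :
    ContDiff ℝ ∞ A := by
  induction hA with
  | metric M N => exact h.genMetric.smooth M N
  | dilaton => exact h.smooth_dil
  | param M => exact h.smooth_param M
  | deriv M A _ ih => exact ih.pd M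

/-- Polarization: `∂^M ∂_M` kills `A`, `B` and `AB`, so the cross term `2 ∂^M A ∂_M B` of the
Leibniz rule vanishes. -/
theorem Admissible.sum_pd_mul_pd (h : Admissible H d ξ) {A B : Pt D → ℝ} (hA : IsField H d ξ A)
    (hB : IsField H d ξ B) (X : Pt D) : ∑ a, pd (bar a) A X * pd a B X = 0 := by
  have e := box_mul (h.contDiff hA) (h.contDiff hB) X
  rw [h.strong.2 A B hA hB X, h.strong.1 A hA X, h.strong.1 B hB X] at e
  linarith

theorem Admissible.sum_pd_pd (h : Admissible H d ξ) {A : Pt D → ℝ} (hA : IsField H d ξ A)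
    (X : Pt D) : ∑ a, pd a (pd (bar a) A) X = 0 := by
  rw [← box_eq]
  exact h.strong.1 A hA X

theorem IsGenMetric.sum_mul (h : IsGenMetric H) (X : Pt D) (M N : Idx D) :
    ∑ a, H X M a * H X (bar a) N = if N = bar M then 1 else 0 := by
  rw [← eta_apply, ← h.constr X, mul_assoc, Matrix.mul_apply]
  exact Finset.sum_congr rfl fun a _ => by
    rw [show (eta D * H X) a N = H X (bar a) N from sMat_apply H X a N]

/-- The derivatives `∂_k ∂_m ξ_p`, with all indices down. -/
noncomputable def pd2Param (ξ : VecField D) (X : Pt D) (k m p : Idx D) : ℝ :=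
  pd k (pd m (fun Y => ξ Y (bar p))) X

/-- The derivatives `∂_k ∂_l ∂_m ξ_p`, with all indices down. -/
noncomputable def pd3Param (ξ : VecField D) (X : Pt D) (k l m p : Idx D) : ℝ :=
  pd k (pd l (pd m (fun Y => ξ Y (bar p)))) X

theorem Admissible.jetRelations (h : Admissible H d ξ) (X : Pt D) :
    JetRelations bar (fieldJet H d X).h (fieldJet H d X).h1 (fieldJet H d X).d1
      (pd2Param ξ X) (pd3Param ξ X) where
  invol := bar_bar
  h_symm a b := (h.genMetric.symm X).apply b a
  s_symm k a b := by
    have : (fun Y => H Y a b) = fun Y => H Y b a :=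
      funext fun Y => (h.genMetric.symm Y).apply b a
    simp only [fieldJet, this]
  x_symm k m p := congrFun (pd_comm (h.smooth_param _) k m) X
  y_symm k l m p := congrFun (pd_comm ((h.smooth_param _).pd m) k l) X
  y_symm' k l m p := by simp only [pd3Param, pd_comm (h.smooth_param _) l m]
  h_h m n := h.genMetric.sum_mul X m n
  s_h k m n := by
    have e : (fun Y => ∑ a, H Y m a * H Y (bar a) n) = fun _ => if n = bar m then 1 else 0 :=
      funext fun Y => h.genMetric.sum_mul Y m n
    have hs := h.genMetric.smooth
    have := congrFun (pd_sum Finset.univ (fun a => (hs m a).mul (hs (bar a) n)) k) X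
    rw [e, pd_const] at this
    refine Eq.trans ?_ this.symm
    exact Finset.sum_congr rfl fun a _ => by rw [pd_mul (hs m a) (hs (bar a) n)]; rfl
  x_s m p q r := h.sum_pd_mul_pd ((IsField.param _).deriv _ _) (.metric _ _) X
  x_d m p := h.sum_pd_mul_pd ((IsField.param _).deriv _ _) .dilaton X
  box_x p := h.sum_pd_pd (.param _) X
  box_y m p := by
    have e : ∀ a, pd3Param ξ X a (bar a) m p = pd a (pd (bar a) (pd m fun Y => ξ Y (bar p))) X :=
      fun a => rfl
    simp only [e]
    exact h.sum_pd_pd ((IsField.param _).deriv _ _) X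

end Constraints

/-! ### The gauge variation of the jet, and of `K` -/

section Lie

variable {H : TensorField D} {d : Pt D → ℝ} {ξ : VecField D}

/-- The matrix `∂_M ξ^P - ∂^P ξ_M` of the generalized Lie derivative. -/
noncomputable def lieMat (ξ : VecField D) (M P : Idx D) (X : Pt D) : ℝ :=
  pd M (fun Y => ξ Y P) X - pd (bar P) (fun Y => ξ Y (bar M)) X

theorem genLie_apply (A : TensorField D) (X : Pt D) (M N : Idx D) :
    genLie ξ A X M N = ∑ P, (ξ X P * pd P (fun Y => A Y M N) X + lieMat ξ M P X * A X P N
      + lieMat ξ N P X * A X M P) := by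
  simp only [genLie, Matrix.of_apply, pdUp_eq, low_eq, lieMat]

/-- With both indices lowered the matrix is an antisymmetrized gradient of `ξ`, hence an element of
the Lie algebra of `O(D,D)`, as `Jet.kinVar_rot` requires. -/
theorem lieMat_bar (a b : Idx D) (X : Pt D) :
    lieMat ξ (bar a) (bar b) X = -lieMat ξ b a X := by
  simp only [lieMat, bar_bar]
  ring

theorem contDiff_lieMat (hξ : ∀ M, ContDiff ℝ ∞ (fun X => ξ X M)) (M P : Idx D) :
    ContDiff ℝ ∞ (lieMat ξ M P) := ((hξ _).pd _).sub ((hξ _).pd _)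

theorem pd_lieMat (hξ : ∀ M, ContDiff ℝ ∞ (fun X => ξ X M)) (k M P : Idx D) (X : Pt D) :
    pd k (lieMat ξ M P) X = pd2Param ξ X k M (bar P) - pd2Param ξ X k (bar P) M := by
  simp only [pd2Param, bar_bar]
  exact congrFun (pd_sub ((hξ P).pd M) ((hξ (bar M)).pd (bar P)) k) X

theorem pd_pd_lieMat (hξ : ∀ M, ContDiff ℝ ∞ (fun X => ξ X M)) (k l M P : Idx D) (X : Pt D) :
    pd k (pd l (lieMat ξ M P)) X = pd3Param ξ X k l M (bar P) - pd3Param ξ X k l (bar P) M := by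
  have : pd l (lieMat ξ M P) = fun Y =>
      pd l (pd M fun Z => ξ Z P) Y - pd l (pd (bar P) fun Z => ξ Z (bar M)) Y :=
    pd_sub ((hξ P).pd M) ((hξ (bar M)).pd (bar P)) l
  rw [this, pd_sub (((hξ P).pd M).pd l) (((hξ (bar M)).pd (bar P)).pd l)]
  simp only [pd3Param, bar_bar]

theorem contDiff_genLie (hξ : ∀ M, ContDiff ℝ ∞ (fun X => ξ X M)) {A : TensorField D}
    (hA : ∀ M N, ContDiff ℝ ∞ (fun X => A X M N)) (M N : Idx D) :
    ContDiff ℝ ∞ (fun X => genLie ξ A X M N) := by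
  simp only [genLie_apply]
  exact ContDiff.sum fun P _ => (((hξ P).mul ((hA _ _).pd _)).add
    ((contDiff_lieMat hξ M P).mul (hA _ _))).add ((contDiff_lieMat hξ N P).mul (hA _ _))

theorem varDil_eq :
    varDil ξ d = fun X => ∑ P, (-(1 / 2) * pd P (fun Y => ξ Y P) X + ξ X P * pd P d X) := by
  funext X
  simp only [varDil, divg, Finset.mul_sum, Finset.sum_add_distrib]

theorem contDiff_varDil (hξ : ∀ M, ContDiff ℝ ∞ (fun X => ξ X M)) (hd : ContDiff ℝ ∞ d) :
    ContDiff ℝ ∞ (varDil ξ d) := by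
  rw [varDil_eq]
  exact ContDiff.sum fun P _ => (contDiff_const.mul ((hξ P).pd P)).add ((hξ P).mul (hd.pd P))

/-- The Leibniz rule for a sum of three products. -/
theorem pd_sum_mul {ι : Type*} [Fintype ι] {f g p q r s : ι → Pt D → ℝ}
    (hf : ∀ i, ContDiff ℝ ∞ (f i)) (hg : ∀ i, ContDiff ℝ ∞ (g i)) (hp : ∀ i, ContDiff ℝ ∞ (p i))
    (hq : ∀ i, ContDiff ℝ ∞ (q i)) (hr : ∀ i, ContDiff ℝ ∞ (r i)) (hs : ∀ i, ContDiff ℝ ∞ (s i))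
    (k : Idx D) :
    pd k (fun Y => ∑ i, (f i Y * g i Y + p i Y * q i Y + r i Y * s i Y)) = fun Y =>
      ∑ i, (pd k (f i) Y * g i Y + pd k (p i) Y * q i Y + pd k (r i) Y * s i Y)
      + ∑ i, (f i Y * pd k (g i) Y + p i Y * pd k (q i) Y + r i Y * pd k (s i) Y) := by
  rw [pd_sum _ fun i => (((hf i).mul (hg i)).add ((hp i).mul (hq i))).add ((hr i).mul (hs i))]
  funext Y
  rw [← Finset.sum_add_distrib]
  refine Finset.sum_congr rfl fun i _ => ?_
  rw [pd_add (((hf i).mul (hg i)).add ((hp i).mul (hq i))) ((hr i).mul (hs i)),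
    pd_add ((hf i).mul (hg i)) ((hp i).mul (hq i)), pd_mul (hf i) (hg i), pd_mul (hp i) (hq i),
    pd_mul (hr i) (hs i)]
  ring

theorem pd_genLie (hξ : ∀ M, ContDiff ℝ ∞ (fun X => ξ X M))
    (hH : ∀ M N, ContDiff ℝ ∞ (fun X => H X M N)) (k M N : Idx D) :
    pd k (fun Y => genLie ξ H Y M N) = fun Y =>
      ∑ P, (pd k (fun Z => ξ Z P) Y * pd P (fun Z => H Z M N) Y + pd k (lieMat ξ M P) Y * H Y P N
        + pd k (lieMat ξ N P) Y * H Y M P)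
      + ∑ P, (ξ Y P * pd k (pd P (fun Z => H Z M N)) Y
        + lieMat ξ M P Y * pd k (fun Z => H Z P N) Y
        + lieMat ξ N P Y * pd k (fun Z => H Z M P) Y) := by
  simp only [genLie_apply]
  exact pd_sum_mul hξ (fun P => (hH _ _).pd _) (contDiff_lieMat hξ M) (fun P => hH _ _)
    (contDiff_lieMat hξ N) (fun P => hH _ _) k

theorem pd_pd_genLie (hξ : ∀ M, ContDiff ℝ ∞ (fun X => ξ X M))
    (hH : ∀ M N, ContDiff ℝ ∞ (fun X => H X M N)) (k l M N : Idx D) (Y : Pt D) :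
    pd k (pd l (fun Y => genLie ξ H Y M N)) Y =
      ∑ P, (pd k (pd l (fun Z => ξ Z P)) Y * pd P (fun Z => H Z M N) Y
        + pd k (pd l (lieMat ξ M P)) Y * H Y P N + pd k (pd l (lieMat ξ N P)) Y * H Y M P)
      + ∑ P, (pd l (fun Z => ξ Z P) Y * pd k (pd P (fun Z => H Z M N)) Y
        + pd l (lieMat ξ M P) Y * pd k (fun Z => H Z P N) Y
        + pd l (lieMat ξ N P) Y * pd k (fun Z => H Z M P) Y)
      + (∑ P, (pd k (fun Z => ξ Z P) Y * pd l (pd P (fun Z => H Z M N)) Y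
        + pd k (lieMat ξ M P) Y * pd l (fun Z => H Z P N) Y
        + pd k (lieMat ξ N P) Y * pd l (fun Z => H Z M P) Y)
      + ∑ P, (ξ Y P * pd k (pd l (pd P (fun Z => H Z M N))) Y
        + lieMat ξ M P Y * pd k (pd l (fun Z => H Z P N)) Y
        + lieMat ξ N P Y * pd k (pd l (fun Z => H Z M P)) Y)) := by
  have hA := contDiff_lieMat hξ
  rw [pd_genLie hξ hH, pd_add
    (ContDiff.sum fun P _ => ((((hξ P).pd l).mul ((hH _ _).pd _)).add
      (((hA M P).pd l).mul (hH _ _))).add (((hA N P).pd l).mul (hH _ _)))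
    (ContDiff.sum fun P _ => (((hξ P).mul (((hH _ _).pd _).pd _)).add
      ((hA M P).mul ((hH _ _).pd _))).add ((hA N P).mul ((hH _ _).pd _)))]
  rw [pd_sum_mul (fun P => (hξ P).pd l) (fun P => (hH M N).pd P) (fun P => (hA M P).pd l)
    (fun P => hH P N) (fun P => (hA N P).pd l) (fun P => hH M P) k,
    pd_sum_mul hξ (fun P => ((hH M N).pd P).pd l) (hA M) (fun P => (hH P N).pd l) (hA N)
    (fun P => (hH M P).pd l) k]

theorem pd_varDil (hξ : ∀ M, ContDiff ℝ ∞ (fun X => ξ X M)) (hd : ContDiff ℝ ∞ d) (k : Idx D) :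
    pd k (varDil ξ d) = fun Y => ∑ P, (-(1 / 2) * pd k (pd P fun Z => ξ Z P) Y
      + pd k (fun Z => ξ Z P) Y * pd P d Y + ξ Y P * pd k (pd P d) Y) := by
  rw [varDil_eq, pd_sum _ fun P => (contDiff_const.mul ((hξ P).pd P)).add
    ((hξ P).mul (hd.pd P))]
  funext Y
  refine Finset.sum_congr rfl fun P _ => ?_
  rw [pd_add (contDiff_const.mul ((hξ P).pd P)) ((hξ P).mul (hd.pd P)),
    pd_const_mul ((hξ P).pd P), pd_mul (hξ P) (hd.pd P)]
  ring

theorem pd_pd_varDil (hξ : ∀ M, ContDiff ℝ ∞ (fun X => ξ X M)) (hd : ContDiff ℝ ∞ d)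
    (k l : Idx D) (Y : Pt D) :
    pd k (pd l (varDil ξ d)) Y = ∑ P, (-(1 / 2) * pd k (pd l (pd P fun Z => ξ Z P)) Y
      + (pd k (pd l (fun Z => ξ Z P)) Y * pd P d Y + pd l (fun Z => ξ Z P) Y * pd k (pd P d) Y)
      + (pd k (fun Z => ξ Z P) Y * pd l (pd P d) Y + ξ Y P * pd k (pd l (pd P d)) Y)) := by
  have h1 := fun P => (contDiff_const (c := (-(1 / 2) : ℝ))).mul (((hξ P).pd P).pd l)
  have h2 := fun P => ((hξ P).pd l).mul (hd.pd P)
  have h3 := fun P => (hξ P).mul ((hd.pd P).pd l)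
  rw [pd_varDil hξ hd, pd_sum _ fun P => ((h1 P).add (h2 P)).add (h3 P)]
  refine Finset.sum_congr rfl fun P _ => ?_
  rw [pd_add ((h1 P).add (h2 P)) (h3 P), pd_add (h1 P) (h2 P),
    pd_const_mul (((hξ P).pd P).pd l), pd_mul ((hξ P).pd l) (hd.pd P),
    pd_mul (hξ P) ((hd.pd P).pd l)]

/-- The variation of the jet of the fields: transport, an infinitesimal `O(D,D)` transformation,
and the non-tensorial terms. -/
theorem Admissible.fieldJet_variation (h : Admissible H d ξ) (X : Pt D) :
    fieldJet (genLie ξ H) (varDil ξ d) X =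
      (Jet.combo (ξ X) (fieldJetDeriv H d X)).add
        ((Jet.combo (fun _ => 1) ((fieldJet H d X).rotTerm fun M P => lieMat ξ M P X)).add
          (Jet.combo (fun _ => 1) (anomaly bar (fieldJet H d X).h (fieldJet H d X).h1
            (fieldJet H d X).d1 (pd2Param ξ X) (pd3Param ξ X)))) := by
  have hξ := h.smooth_param
  have hH := h.genMetric.smooth
  have hd := h.smooth_dil
  have z : ∀ {B : Pt D → ℝ}, IsField H d ξ B → ∀ m,
      ∑ P, pd (bar P) (fun Y => ξ Y m) X * pd P B X = 0 := fun hB m =>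
    h.sum_pd_mul_pd (.param m) hB X
  simp only [fieldJet, Jet.add, Jet.combo, Jet.rotTerm, anomaly, fieldJetDeriv, Jet.mk.injEq,
    one_mul]
  refine ⟨?_, ?_, ?_, ?_, ?_⟩
  · funext a b
    rw [genLie_apply]
    simp only [← Finset.sum_add_distrib]
    exact Finset.sum_congr rfl fun P _ => by ring
  · funext k a b
    -- Differentiating `ξ^P ∂_P H` rotates the derivative index by `∂_k ξ^P` alone. The missing part
    -- `-∂^P ξ_k` of the rotation may be added because `∂^P ξ_k ∂_P H = 0`. The other derivatives
    -- below are completed in the same way, once for each derivative index.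
    refine sub_eq_zero.mp (Eq.trans ?_ (z (.metric a b) (bar k)))
    rw [pd_genLie hξ hH]
    simp only [← Finset.sum_add_distrib, ← Finset.sum_sub_distrib]
    refine Finset.sum_congr rfl fun P _ => ?_
    rw [pd_lieMat hξ, pd_lieMat hξ, pd_comm (hH a b) k P]
    simp only [lieMat]
    ring
  · funext k l a b
    have z0 := congrArg₂ (· + ·) (z ((IsField.metric a b).deriv l) (bar k))
      (z ((IsField.metric a b).deriv k) (bar l))
    simp only [add_zero, ← Finset.sum_add_distrib] at z0
    refine sub_eq_zero.mp (Eq.trans ?_ z0)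
    rw [pd_pd_genLie hξ hH]
    simp only [← Finset.sum_add_distrib, ← Finset.sum_sub_distrib]
    refine Finset.sum_congr rfl fun P _ => ?_
    simp only [pd_pd_lieMat hξ, pd_lieMat hξ, pd_comm (hH a b) l P, pd_comm (hH a b) k P,
      pd_comm ((hH a b).pd l) k P, lieMat, pd2Param, pd3Param, bar_bar]
    ring
  · funext k
    refine sub_eq_zero.mp (Eq.trans ?_ (z .dilaton (bar k)))
    rw [pd_varDil hξ hd]
    simp only [← Finset.sum_add_distrib, ← Finset.sum_sub_distrib]
    refine Finset.sum_congr rfl fun P _ => ?_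
    simp only [pd_comm hd k P, lieMat, pd2Param, bar_bar]
    ring
  · funext k l
    have z0 := congrArg₂ (· + ·) (z (IsField.dilaton.deriv l) (bar k))
      (z (IsField.dilaton.deriv k) (bar l))
    simp only [add_zero, ← Finset.sum_add_distrib] at z0
    refine sub_eq_zero.mp (Eq.trans ?_ z0)
    rw [pd_pd_varDil hξ hd]
    simp only [← Finset.sum_add_distrib, ← Finset.sum_sub_distrib]
    refine Finset.sum_congr rfl fun P _ => ?_
    simp only [pd_comm hd l P, pd_comm hd k P, pd_comm (hd.pd l) k P, lieMat, pd2Param, pd3Param,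
      bar_bar]
    ring

theorem tAux_eq (X : Pt D) (hξ : ∀ M, ContDiff ℝ ∞ (fun X => ξ X M)) (M N : Idx D) :
    tAux H d ξ X M N = tPart bar (fieldJet H d X).h (fieldJet H d X).h1 (fieldJet H d X).d1
      (pd2Param ξ X) (pd3Param ξ X) M N := by
  have e1 : pd M (pd N (divg ξ)) X = ∑ c, pd3Param ξ X M N c (bar c) := by
    have : divg ξ = fun Y => ∑ P, pd P (fun Z => ξ Z P) Y := rfl
    rw [this, pd_sum _ fun P => (hξ P).pd P, pd_sum _ fun P => ((hξ P).pd P).pd N]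
    simp only [pd3Param, bar_bar]
  have e2 : ∀ L K P, pd L (fun Y => pd K (fun Z => ξ Z P) Y - pdUp P (low ξ K) Y) X =
      pd2Param ξ X L K (bar P) - pd2Param ξ X L (bar P) K := by
    intro L K P
    simp only [pdUp_eq, low_eq]
    exact pd_lieMat hξ L K P X
  have e3 : ∀ A B c, pd2Param ξ X A B (bar c) = pd A (pd B fun Y => ξ Y c) X := by
    intro A B c
    simp only [pd2Param, bar_bar]
  simp only [tAux, e1, e2, tPart, sMat_apply, ← e3]
  have e4 : ∑ L, ∑ P, ∑ K, pd M (fun Y => H Y (bar L) P) X * H X (bar K) N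
      * (pd2Param ξ X L K (bar P) - pd2Param ξ X L (bar P) K) =
      ∑ K, H X (bar K) N * ∑ L, ∑ P, pd M (fun Y => H Y (bar L) P) X
      * (pd2Param ξ X L K (bar P) - pd2Param ξ X L (bar P) K) := by
    simp only [Finset.mul_sum]
    rw [Finset.sum_comm (s := Finset.univ (α := Idx D)) (t := Finset.univ (α := Idx D))
      (f := fun K L => ∑ P, H X (bar K) N * (pd M (fun Y => H Y (bar L) P) X
      * (pd2Param ξ X L K (bar P) - pd2Param ξ X L (bar P) K)))]
    refine Finset.sum_congr rfl fun L _ => ?_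
    rw [Finset.sum_comm]
    exact Finset.sum_congr rfl fun K _ => Finset.sum_congr rfl fun P _ => by ring
  have e5 : ∑ P, ∑ L, ∑ Q, H X (bar P) M * pd2Param ξ X L P (bar Q)
      * pd Q (fun Y => H Y (bar L) N) X =
      ∑ P, H X (bar P) M * ∑ L, ∑ Q, pd2Param ξ X L P (bar Q)
      * pd Q (fun Y => H Y (bar L) N) X := by
    simp only [Finset.mul_sum, mul_assoc]
  rw [e4, e5]
  simp only [fieldJet, ← Finset.mul_sum, Finset.sum_sub_distrib, mul_left_comm _ (1 / 4 : ℝ),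
    mul_left_comm _ (-(1 / 2) : ℝ)]
  ring

theorem genLie_eq (A : TensorField D) (X : Pt D) (M N : Idx D) :
    genLie ξ A X M N = ∑ P, ξ X P * pd P (fun Y => A Y M N) X
      + ∑ P, (lieMat ξ M P X * A X P N + lieMat ξ N P X * A X M P) := by
  rw [genLie_apply, ← Finset.sum_add_distrib]
  exact Finset.sum_congr rfl fun P _ => by ring

/-- The gauge variation of `K`. -/
theorem Admissible.hasGaugeVariation_kField (h : Admissible H d ξ) :
    HasGaugeVariation kField H d ξ (fun X => genLie ξ (kField H d) X
      + (tField H d ξ X + (sMat H X).transpose * tField H d ξ X * sMat H X)) := by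
  intro X M N
  have hξ := h.smooth_param
  have hH := h.genMetric.smooth
  have hd := h.smooth_dil
  have hT : ∀ A B, tField H d ξ X A B = tAux H d ξ X A B + tAux H d ξ X B A := fun A B => rfl
  have hS : ((sMat H X).transpose * tField H d ξ X * sMat H X) M N =
      conjS bar (fieldJet H d X).h (fun A B => tAux H d ξ X A B + tAux H d ξ X B A) M N := by
    rw [Matrix.mul_apply]
    refine Finset.sum_congr rfl fun b _ => ?_
    rw [Matrix.mul_apply, sMat_apply]
    simp only [Matrix.transpose_apply, sMat_apply, hT, fieldJet]
  convert hasDerivAt_kField hH (contDiff_genLie hξ hH) hd (contDiff_varDil hξ hd) X M N using 1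
  -- The three pieces yield, in order, the transport term of the Lie derivative, its matrix terms,
  -- and `T + Sᵗ T S`.
  rw [h.fieldJet_variation, Jet.kinVar_add, Jet.kinVar_add, Jet.kinVar_combo, Jet.kinVar_combo,
    Jet.kinVar_combo]
  simp only [one_mul, Matrix.add_apply]
  rw [Jet.kinVar_rot bar bar_bar (fun M P => lieMat ξ M P X) (fun a b => lieMat_bar a b X),
    (h.jetRelations X).sum_kinVar_anomaly rfl rfl rfl, hS, genLie_eq, hT]
  simp only [tAux_eq X hξ, ← kField_eq hH, pd_kField hH hd]
  ring

end Lie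

/-! ### Entrywise derivatives of curves of matrices -/

section MatrixCurves

variable {n : Type*} {A B : ℝ → Matrix n n ℝ} {A' B' : Matrix n n ℝ}

/-- `A'` is the entrywise derivative at `0` of the curve `A` of matrices. -/
def HasEntryDeriv (A : ℝ → Matrix n n ℝ) (A' : Matrix n n ℝ) : Prop :=
  ∀ i j, HasDerivAt (fun t => A t i j) (A' i j) 0

theorem HasEntryDeriv.sub (hA : HasEntryDeriv A A') (hB : HasEntryDeriv B B') :
    HasEntryDeriv (fun t => A t - B t) (A' - B') := fun i j => (hA i j).fun_sub (hB i j)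

theorem HasEntryDeriv.const_smul (hA : HasEntryDeriv A A') (c : ℝ) :
    HasEntryDeriv (fun t => c • A t) (c • A') := fun i j => (hA i j).const_mul c

theorem HasEntryDeriv.transpose (hA : HasEntryDeriv A A') :
    HasEntryDeriv (fun t => (A t).transpose) A'.transpose := fun i j => hA j i

variable [Fintype n]

theorem HasEntryDeriv.mul (hA : HasEntryDeriv A A') (hB : HasEntryDeriv B B') :
    HasEntryDeriv (fun t => A t * B t) (A' * B 0 + A 0 * B') := by
  intro i j
  simp only [Matrix.mul_apply, Matrix.add_apply, ← Finset.sum_add_distrib]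
  exact HasDerivAt.fun_sum fun k _ => (hA i k).fun_mul (hB k j)

/-- The product rule for `R = ½ (K - Sᵗ K S)` is needed for two curves, the gauge variation and the
translation along `ξ`; comparing the two outcomes gives `Δ_ξ R`. -/
theorem HasEntryDeriv.conj {S K : ℝ → Matrix n n ℝ} {S' K' : Matrix n n ℝ}
    (hS : HasEntryDeriv S S') (hK : HasEntryDeriv K K') :
    HasEntryDeriv (fun t => (1 / 2 : ℝ) • (K t - (S t).transpose * K t * S t))
      ((1 / 2 : ℝ) • (K' - ((S'.transpose * K 0 + (S 0).transpose * K') * S 0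
        + (S 0).transpose * K 0 * S'))) :=
  (hK.sub ((hS.transpose.mul hK).mul hS)).const_smul _

end MatrixCurves

/-! ### Covariance of `R` -/

section Tensor

variable {H : TensorField D} {d : Pt D → ℝ} {ξ : VecField D}

theorem hasDerivAt_transport {f : Pt D → ℝ} (hf : ContDiff ℝ ∞ f) (v X : Pt D) :
    HasDerivAt (fun t : ℝ => f (X + t • v)) (∑ P, v P * pd P f X) 0 := by
  have e : fderiv ℝ f X v = ∑ P, v P * pd P f X := by
    conv_lhs => rw [pi_eq_sum_univ' v]
    simp [pd, map_sum]
  rw [← e]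
  exact ((hf.differentiable (by simp)) X).hasFDerivAt.hasLineDerivAt _

/-- The transport term `ξ^P ∂_P A` of the generalized Lie derivative. -/
noncomputable def transport (ξ : VecField D) (A : TensorField D) : TensorField D := fun X =>
  Matrix.of fun M N => ∑ P, ξ X P * pd P (fun Y => A Y M N) X

theorem hasEntryDeriv_transport {A : TensorField D}
    (hA : ∀ M N, ContDiff ℝ ∞ (fun X => A X M N)) (ξ : VecField D) (X : Pt D) :
    HasEntryDeriv (fun t => A (X + t • ξ X)) (transport ξ A X) :=
  fun M N => hasDerivAt_transport (hA M N) (ξ X) X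

theorem genLie_eq_matrix (ξ : VecField D) (A : TensorField D) (X : Pt D) :
    genLie ξ A X = transport ξ A X + (Matrix.of fun M P => lieMat ξ M P X) * A X
      + A X * (Matrix.of fun M P => lieMat ξ M P X).transpose := by
  ext M N
  rw [genLie_eq, Matrix.add_apply, Matrix.add_apply, Matrix.mul_apply, Matrix.mul_apply,
    Finset.sum_add_distrib, ← add_assoc]
  simp only [transport, Matrix.of_apply, Matrix.transpose_apply, mul_comm]

/-- The terms linear in `S` cancel between the two products, so `R` is half the difference between
`K` and its conjugate by `S`. -/
theorem rField_eq (H : TensorField D) (d : Pt D → ℝ) (X : Pt D) :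
    rField H d X =
      (1 / 2 : ℝ) • (kField H d X - (sMat H X).transpose * kField H d X * sMat H X) := by
  have e : ∀ S K : Matrix (Idx D) (Idx D) ℝ,
      (1 - S.transpose) * K * (1 + S) + (1 + S.transpose) * K * (1 - S) =
      (2 : ℝ) • (K - S.transpose * K * S) := by
    intro S K
    rw [two_smul]
    noncomm_ring
  rw [rField, ← smul_add, e, smul_smul]
  norm_num

theorem eta_mul_eta : eta D * eta D = 1 := by
  simp [eta, Matrix.fromBlocks_multiply]

theorem IsGenMetric.sMat_mul_sMat (h : IsGenMetric H) (X : Pt D) : sMat H X * sMat H X = 1 := by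
  rw [sMat, mul_assoc, ← mul_assoc (H X), h.constr, eta_mul_eta]

theorem contDiff_sMat (hH : ∀ M N, ContDiff ℝ ∞ (fun X => H X M N)) (M N : Idx D) :
    ContDiff ℝ ∞ (fun X => sMat H X M N) := by
  simp only [sMat_apply]
  exact hH _ _

theorem contDiff_kField (hH : ∀ M N, ContDiff ℝ ∞ (fun X => H X M N)) (hd : ContDiff ℝ ∞ d)
    (M N : Idx D) : ContDiff ℝ ∞ (fun X => kField H d X M N) := by
  simp only [kField_eq hH]
  exact contDiff_kin hH hd M N

theorem contDiff_rField (hH : ∀ M N, ContDiff ℝ ∞ (fun X => H X M N)) (hd : ContDiff ℝ ∞ d)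
    (M N : Idx D) : ContDiff ℝ ∞ (fun X => rField H d X M N) := by
  have hS := contDiff_sMat hH
  have hK := contDiff_kField hH hd
  simp only [rField_eq, Matrix.smul_apply, Matrix.sub_apply, Matrix.mul_apply,
    Matrix.transpose_apply, smul_eq_mul]
  exact contDiff_const.mul ((hK M N).sub (ContDiff.sum fun b _ =>
    (ContDiff.sum fun a _ => (hS a M).mul (hK a b)).mul (hS b N)))

/-- The gauge variation of the mixed components `S` of the generalized metric. -/
theorem eta_mul_genLie (X : Pt D) :
    eta D * genLie ξ H X = eta D * transport ξ H X
      - (Matrix.of fun M P => lieMat ξ M P X).transpose * sMat H X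
      + sMat H X * (Matrix.of fun M P => lieMat ξ M P X).transpose := by
  have e : eta D * (Matrix.of fun M P => lieMat ξ M P X) =
      -((Matrix.of fun M P => lieMat ξ M P X).transpose * eta D) := by
    ext M N
    rw [Matrix.neg_apply, Matrix.mul_apply, Matrix.mul_apply,
      sum_eta_mul M (fun K => Matrix.of (fun M P => lieMat ξ M P X) K N), sum_mul_eta N
      (fun K => (Matrix.of fun M P => lieMat ξ M P X).transpose M K)]
    simp only [Matrix.of_apply, Matrix.transpose_apply]
    rw [← lieMat_bar, bar_bar]
  rw [genLie_eq_matrix, sMat, mul_add, mul_add, ← mul_assoc, ← mul_assoc, ← mul_assoc, e]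
  noncomm_ring

/-- `R` is a generalized tensor. -/
theorem Admissible.hasGaugeVariation_rField (h : Admissible H d ξ) :
    HasGaugeVariation rField H d ξ (genLie ξ (rField H d)) := by
  intro X
  have hH := h.genMetric.smooth
  have hd := h.smooth_dil
  have hS2 := h.genMetric.sMat_mul_sMat X
  have hS2' : (sMat H X).transpose * (sMat H X).transpose = 1 := by
    rw [← Matrix.transpose_mul, hS2, Matrix.transpose_one]
  have hvS : HasEntryDeriv (fun ε : ℝ => sMat (H + ε • genLie ξ H) X)
      (eta D * genLie ξ H X) := by
    intro M N
    have e : ∀ ε : ℝ, sMat (H + ε • genLie ξ H) X M N =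
        sMat H X M N + ε * (eta D * genLie ξ H X) M N := by
      intro ε
      simp [sMat, mul_add]
    simp only [e]
    exact hasDerivAt_add_mul _ _
  have hvR := hvS.conj (fun M N => h.hasGaugeVariation_kField X M N)
  have htS := hasEntryDeriv_transport (contDiff_sMat hH) ξ X
  have htR := htS.conj (hasEntryDeriv_transport (contDiff_kField hH hd) ξ X)
  have hR := hasEntryDeriv_transport (contDiff_rField hH hd) ξ X
  have hS' : transport ξ (sMat H) X = eta D * transport ξ H X := by
    ext M N
    rw [Matrix.mul_apply, sum_eta_mul M (fun K => transport ξ H X K N)]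
    simp only [transport, Matrix.of_apply, sMat_apply]
  simp only [zero_smul, add_zero] at hvR htR
  -- The derivative of `R` along `ξ`, computed directly and by the product rule, expresses the
  -- transport of `R` through those of `S` and `K`.
  have e := fun M N => (hR M N).unique (by simpa only [rField_eq] using htR M N)
  have e' := Matrix.ext e
  have key : genLie ξ (rField H d) X = (1 / 2 : ℝ) • (genLie ξ (kField H d) X + (tField H d ξ X
      + (sMat H X).transpose * tField H d ξ X * sMat H X)
      - (((eta D * genLie ξ H X).transpose * kField H d X + (sMat H X).transpose *
        (genLie ξ (kField H d) X + (tField H d ξ X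
          + (sMat H X).transpose * tField H d ξ X * sMat H X))) * sMat H X
        + (sMat H X).transpose * kField H d X * (eta D * genLie ξ H X))) := by
    -- Conjugating twice by `S` is the identity, so the anomaly of `K` cancels in `R`. The rest of
    -- `key` is noncommutative algebra, in which the Lie matrix drops out.
    have hT : (sMat H X).transpose * ((sMat H X).transpose * tField H d ξ X * sMat H X)
        * sMat H X = tField H d ξ X := by
      rw [← mul_assoc, ← mul_assoc, hS2', mul_assoc, hS2, one_mul, mul_one]
    rw [genLie_eq_matrix ξ (rField H d), e', rField_eq, eta_mul_genLie,
      genLie_eq_matrix ξ (kField H d), hS', Matrix.mul_smul, Matrix.smul_mul, ← smul_add,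
      ← smul_add]
    congr 1
    simp only [Matrix.transpose_add, Matrix.transpose_sub, Matrix.transpose_mul,
      Matrix.transpose_transpose]
    linear_combination (norm := noncomm_ring) hT
  intro M N
  have hv := hvR M N
  rw [← key] at hv
  simpa only [rField_eq] using hv

end Tensor

/-! ### A flat background where `K` is not a tensor -/

section Counterexample

theorem pd_comp_eval {f : ℝ → ℝ} (hf : ContDiff ℝ ∞ f) (k M : Idx D) :
    pd M (fun X => f (X k)) = fun X => if M = k then deriv f (X k) else 0 := by
  have hc : ContDiff ℝ ∞ (fun X : Pt D => f (X k)) := hf.comp (contDiff_apply ℝ ℝ k)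
  funext X
  refine pd_eq_of_hasDerivAt hc ?_
  by_cases h : M = k
  · subst h
    simp only [if_true, Pi.add_apply, Pi.smul_apply, Pi.single_eq_same, smul_eq_mul, mul_one]
    have := ((hf.differentiable (by simp)) (X M)).hasDerivAt
    rw [← add_zero (X M)] at this
    simpa using HasDerivAt.comp_const_add (X M) 0 this
  · have h' : k ≠ M := fun e => h e.symm
    simp only [h, if_false, Pi.add_apply, Pi.smul_apply, Pi.single_eq_of_ne h', smul_zero,
      add_zero]
    exact hasDerivAt_const _ _

theorem bar_ne (k : Idx D) : bar k ≠ k := by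
  rcases k with i | i <;> simp [bar]

/-- The metric `η` pairs each coordinate with a different one, so one of the two derivatives in
every term of `∂^M ∂_M` kills a function of `X^k` alone. -/
theorem box_comp_eval {f : ℝ → ℝ} (hf : ContDiff ℝ ∞ f) (k : Idx D) (X : Pt D) :
    box (fun Y => f (Y k)) X = 0 := by
  rw [box_eq]
  refine Finset.sum_eq_zero fun a _ => ?_
  rw [pd_comp_eval hf]
  by_cases h : bar a = k
  · have ha : a ≠ k := fun e => bar_ne k (by rw [← e, h, e])
    simp only [h, if_true]
    rw [pd_comp_eval (f := deriv f) (contDiff_infty_iff_deriv.1 hf).2]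
    simp [ha]
  · simp only [h, if_false]
    rw [pd_const]

/-- The gauge parameter whose only component is `ξ^k = (X^k)³`. -/
def cubicParam (k : Idx D) : VecField D := fun X M => if M = k then X k ^ 3 else 0

/-- Functions of the single coordinate `X^k` are closed under derivatives. They are also closed
under products, so the strong constraint for this configuration reduces to `box_comp_eval`. -/
theorem isField_eq_comp_eval (k : Idx D) {A : Pt D → ℝ}
    (hA : IsField (fun _ => 1) (fun _ => 0) (cubicParam k) A) :
    ∃ f : ℝ → ℝ, ContDiff ℝ ∞ f ∧ A = fun X => f (X k) := by
  induction hA with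
  | metric M N => exact ⟨fun _ => (1 : Matrix (Idx D) (Idx D) ℝ) M N, contDiff_const, rfl⟩
  | dilaton => exact ⟨fun _ => 0, contDiff_const, rfl⟩
  | param M =>
    by_cases h : M = k
    · exact ⟨fun t => t ^ 3, contDiff_id.pow 3, by simp [cubicParam, h]⟩
    · exact ⟨fun _ => 0, contDiff_const, by simp [cubicParam, h]⟩
  | deriv M A _ ih =>
    obtain ⟨f, hf, rfl⟩ := ih
    rw [pd_comp_eval hf]
    by_cases h : M = k
    · exact ⟨deriv f, (contDiff_infty_iff_deriv.1 hf).2, by simp [h]⟩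
    · exact ⟨fun _ => 0, contDiff_const, by simp [h]⟩

theorem admissible_cubicParam (k : Idx D) :
    Admissible (fun _ => 1) (fun _ => 0) (cubicParam k) where
  genMetric := ⟨fun _ _ => contDiff_const, fun _ => Matrix.isSymm_one, fun _ => by simp⟩
  smooth_dil := contDiff_const
  smooth_param M := by
    by_cases h : M = k
    · simpa [cubicParam, h] using (contDiff_apply ℝ ℝ k).pow 3
    · simpa [cubicParam, h] using contDiff_const
  strong := by
    constructor
    · intro A hA X
      obtain ⟨f, hf, rfl⟩ := isField_eq_comp_eval k hA
      exact box_comp_eval hf k X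
    · intro A B hA hB X
      obtain ⟨f, hf, rfl⟩ := isField_eq_comp_eval k hA
      obtain ⟨g, hg, rfl⟩ := isField_eq_comp_eval k hB
      exact box_comp_eval (hf.mul hg) k X

theorem metricOf_one_zero : metricOf (D := D) (fun _ => 1) (fun _ => 0) = fun _ => 1 := by
  funext X
  simp [metricOf]

theorem divg_cubicParam (k : Idx D) : divg (cubicParam k) = fun X => 3 * X k ^ 2 := by
  funext X
  rw [divg, Finset.sum_eq_single k]
  · have : (fun Y => cubicParam k Y k) = fun Y : Pt D => Y k ^ 3 := by simp [cubicParam]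
    rw [this, pd_comp_eval (f := fun t => t ^ 3) (contDiff_id.pow 3)]
    simp
  · intro P _ hP
    have : (fun Y => cubicParam k Y P) = fun _ : Pt D => (0 : ℝ) := by simp [cubicParam, hP]
    rw [this, pd_const]
  · simp

/-- Since `H` and `d` are constant, only `-¼ ∂_M ∂_N (∂ · ξ)` and its mirror survive. The cube is
the lowest power of `X^k` with a nonzero third derivative, here `6`, and `-6/4 - 6/4 = -3`. -/
theorem tField_cubicParam (k M : Idx D) (X : Pt D) :
    tField (fun _ => 1) (fun _ => 0) (cubicParam k) X M M = if M = k then -3 else 0 := by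
  have e1 : ∀ K L, (fun Y : Pt D => sMat (fun _ => 1) Y K L) = fun _ => eta D K L := by
    intro K L
    simp [sMat]
  have e2 : pd M (pd M (divg (cubicParam k))) X = if M = k then 6 else 0 := by
    rw [divg_cubicParam, pd_comp_eval (f := fun t => 3 * t ^ 2)
      (contDiff_const.mul (contDiff_id.pow 2))]
    by_cases h : M = k
    · have : deriv (fun t : ℝ => 3 * t ^ 2) = fun t => 6 * t := by
        funext t
        simp
        ring
      simp only [h, if_true, this]
      rw [pd_comp_eval (f := fun t => 6 * t) (contDiff_const.mul contDiff_id)]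
      simp
    · simp only [h, if_false, pd_const]
  simp only [tField, Matrix.of_apply, tAux, e1, e2, pd_const, mul_zero, zero_mul,
    Finset.sum_const_zero]
  split_ifs <;> norm_num

/-- `K` is not a generalized tensor. -/
theorem not_hasGaugeVariation_kField (k : Idx D) :
    ¬ HasGaugeVariation kField (fun _ => 1) (fun _ => 0) (cubicParam k)
      (genLie (cubicParam k) (kField (fun _ => 1) (fun _ => 0))) := by
  intro h
  have e := ((admissible_cubicParam k).hasGaugeVariation_kField 0 k k).unique (h 0 k k)
  have hS : sMat (fun _ => 1) (0 : Pt D) = eta D := by simp [sMat]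
  -- For `H = 1` the matrix `S` is `η`, which exchanges `k` with its partner. The conjugated term
  -- thus contributes the component of `T` along the partner index, which is zero and cannot cancel
  -- the `-3`.
  have hT : ((eta D).transpose * tField (fun _ => 1) (fun _ => 0) (cubicParam k) 0 * eta D) k k =
      tField (fun _ => 1) (fun _ => 0) (cubicParam k) 0 (bar k) (bar k) := by
    rw [Matrix.mul_apply, sum_mul_eta k (fun K => ((eta D).transpose * tField (fun _ => 1)
      (fun _ => 0) (cubicParam k) 0) k K), Matrix.mul_apply]
    simp only [Matrix.transpose_apply, mul_comm (eta D _ _)]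
    exact sum_mul_eta k _
  beta_reduce at e
  rw [Matrix.add_apply, Matrix.add_apply, hS, hT, tField_cubicParam, tField_cubicParam] at e
  simp [bar_ne] at e

end Counterexample

end DFT

theorem mainTheorem6 (D : ℕ) :
    (∀ (H : DFT.TensorField D) (d : DFT.Pt D → ℝ) (ξ : DFT.VecField D), DFT.Admissible H d ξ →
      DFT.HasGaugeVariation DFT.kField H d ξ
        (fun X => DFT.genLie ξ (DFT.kField H d) X
          + (DFT.tField H d ξ X
            + (DFT.sMat H X).transpose * DFT.tField H d ξ X * DFT.sMat H X))) ∧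
    (∀ (H : DFT.TensorField D) (d : DFT.Pt D → ℝ) (ξ : DFT.VecField D), DFT.Admissible H d ξ →
      DFT.HasGaugeVariation DFT.rField H d ξ (DFT.genLie ξ (DFT.rField H d))) ∧
    (1 ≤ D →
      ∃ (g b : DFT.Pt D → Matrix (Fin D) (Fin D) ℝ) (d : DFT.Pt D → ℝ) (ξ : DFT.VecField D),
        (∀ i j, ContDiff ℝ ∞ (fun X => g X i j)) ∧ (∀ X, (g X).IsSymm) ∧ (∀ X, (g X).det ≠ 0) ∧
        (∀ i j, ContDiff ℝ ∞ (fun X => b X i j)) ∧ (∀ X, (b X).transpose = -b X) ∧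
        DFT.Admissible (DFT.metricOf g b) d ξ ∧
        ¬ DFT.HasGaugeVariation DFT.kField (DFT.metricOf g b) d ξ
          (DFT.genLie ξ (DFT.kField (DFT.metricOf g b) d))) := by
  -- The counterexample is `g = 1`, `b = 0`, `d = 0`, with `ξ` along the first ordinary coordinate,
  -- which exists because `1 ≤ D`.
  refine ⟨fun H d ξ h => h.hasGaugeVariation_kField, fun H d ξ h => h.hasGaugeVariation_rField,
    fun hD => ⟨fun _ => 1, fun _ => 0, fun _ => 0, DFT.cubicParam (.inr ⟨0, hD⟩),
      fun _ _ => contDiff_const, fun _ => Matrix.isSymm_one, fun _ => by simp,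
      fun _ _ => contDiff_const, fun _ => by simp, ?_⟩⟩
  rw [DFT.metricOf_one_zero]
  exact ⟨DFT.admissible_cubicParam _, DFT.not_hasGaugeVariation_kField _⟩
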